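/- Let $M\subset\mathbb{C}^3$ be a real-analytic real hypersurface (of real dimension $5$) whose Levi form, i.e. the Hermitian form $(L_q,K_q)\mapsto \sqrt{-1}\,[L,\overline{K}]_q \bmod T^{1,0}_qM\oplus T^{0,1}_qM$ on $T^{1,0}_qM$, has rank $2$ at every point $q\in M$. Then for every point $p\in M$ there are local holomorphic coordinates $(z_1,z_2,w)$, $w=u+\sqrt{-1}\,v$, of $\mathbb{C}^3$ near $p$, centred at $p$, in which $M$ is the graph $$v=z_1\bar z_1\pm z_2\bar z_2+R(z_1,z_2,\bar z_1,\bar z_2,u)$$ for one choice of the sign $\pm$, where the remainder $R(z_1,z_2,\zeta_1,\zeta_2,u)$ is a convergent power series in five independent variables which contains only terms of total degree at least $3$, takes real values when $\zeta_1=\bar z_1$, $\zeta_2=\bar z_2$ and $u\in\mathbb{R}$, and satisfies $$0\equiv R(0,0,\zeta_1,\zeta_2,u)\equiv R(z_1,z_2,0,0,u).$$ -/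

import Mathlib

open Filter Topology Asymptotics
open scoped ContDiff ComplexConjugate

/-- The ambient space `ℂ³`, with coordinates `(z₁, z₂, w)`. -/
abbrev CThree : Type := ℂ × ℂ × ℂ

/-- A subset `M` of `ℂ³` is a real-analytic hypersurface if near each of its points it is the zero
set of a real-valued real-analytic function with nonzero differential. -/
def IsRealAnalyticHypersurface (M : Set CThree) : Prop :=
  ∀ p ∈ M, ∃ r : CThree → ℝ,
    AnalyticAt ℝ r p ∧ fderiv ℝ r p ≠ 0 ∧ ∀ᶠ q in 𝓝 p, (q ∈ M ↔ r q = 0)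

/-- Complexified tangent vectors `∑ aⱼ ∂/∂zⱼ + ∑ bⱼ ∂/∂z̄ⱼ` of `ℂ³` (elements of `ℂ ⊗ T_p ℂ³`),
stored as the pair `(a, b)` of their coefficient vectors. -/
abbrev CVector : Type := CThree × CThree

/-- `∑ aⱼ ∂f/∂zⱼ (p)`, where `∂/∂zⱼ = (∂/∂xⱼ - i ∂/∂yⱼ) / 2`. -/
noncomputable def dHol {F : Type*} [NormedAddCommGroup F] [NormedSpace ℝ F] [Module ℂ F]
    (f : CThree → F) (p a : CThree) : F :=
  (1 / 2 : ℂ) • (fderiv ℝ f p a - Complex.I • fderiv ℝ f p (Complex.I • a))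

/-- `∑ bⱼ ∂f/∂z̄ⱼ (p)`, where `∂/∂z̄ⱼ = (∂/∂xⱼ + i ∂/∂yⱼ) / 2`. -/
noncomputable def dAntihol {F : Type*} [NormedAddCommGroup F] [NormedSpace ℝ F] [Module ℂ F]
    (f : CThree → F) (p b : CThree) : F :=
  (1 / 2 : ℂ) • (fderiv ℝ f p (star b) + Complex.I • fderiv ℝ f p (Complex.I • star b))

/-- The derivative at `p` of a function `f` along the complexified tangent vector `X`. -/
noncomputable def CVector.deriv {F : Type*} [NormedAddCommGroup F] [NormedSpace ℝ F] [Module ℂ F]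
    (X : CVector) (f : CThree → F) (p : CThree) : F :=
  dHol f p X.1 + dAntihol f p X.2

/-- The Lie bracket of two complexified vector fields: `[X, Y] = X(Y) - Y(X)` on coefficients. -/
noncomputable def cBracket (X Y : CThree → CVector) (p : CThree) : CVector :=
  (X p).deriv Y p - (Y p).deriv X p

theorem fderiv_complex_smul_split {F : Type*} [NormedAddCommGroup F] [NormedSpace ℝ F]
    (f : CThree → F) (p v : CThree) (c : ℂ) :
    fderiv ℝ f p (c • v) = c.re • fderiv ℝ f p v + c.im • fderiv ℝ f p (Complex.I • v) := by
  have h : c • v = c.re • v + c.im • (Complex.I • v) := by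
    conv_lhs => rw [← Complex.re_add_im c]
    rw [add_smul, mul_smul, Complex.coe_smul, Complex.coe_smul]
  rw [h, map_add, map_smul, map_smul]

theorem CVector.deriv_add (X Y : CVector) (f : CThree → ℂ) (p : CThree) :
    (X + Y).deriv f p = X.deriv f p + Y.deriv f p := by
  simp only [CVector.deriv, dHol, dAntihol, Prod.fst_add, Prod.snd_add, star_add, smul_add,
    map_add, smul_eq_mul]
  ring

theorem CVector.deriv_smul (c : ℂ) (X : CVector) (f : CThree → ℂ) (p : CThree) :
    (c • X).deriv f p = c * X.deriv f p := by
  have e1 : Complex.I • c • X.1 = (Complex.I * c) • X.1 := smul_smul _ _ _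
  have e2 : Complex.I • star c • star X.2 = (Complex.I * star c) • star X.2 := smul_smul _ _ _
  simp only [CVector.deriv, dHol, dAntihol, Prod.smul_fst, Prod.smul_snd, star_smul, e1, e2]
  rw [fderiv_complex_smul_split f p X.1 c, fderiv_complex_smul_split f p X.1 (Complex.I * c),
    fderiv_complex_smul_split f p (star X.2) (star c),
    fderiv_complex_smul_split f p (star X.2) (Complex.I * star c)]
  generalize fderiv ℝ f p X.1 = A
  generalize fderiv ℝ f p (Complex.I • X.1) = B
  generalize fderiv ℝ f p (star X.2) = C
  generalize fderiv ℝ f p (Complex.I • star X.2) = D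
  conv_rhs => rw [← Complex.re_add_im c]
  simp only [Complex.real_smul, smul_eq_mul, Complex.mul_re, Complex.mul_im, Complex.I_re,
    Complex.I_im, Complex.star_def, Complex.conj_re, Complex.conj_im]
  push_cast
  linear_combination ((1 / 2) * ((c.im : ℂ) * (B - D))) * Complex.I_sq

/-- The complexified tangent space `ℂ ⊗ T_p M`: the complexified tangent vectors at `p` that
annihilate every real-analytic function that is defined near `p` and vanishes on `M`. -/
noncomputable def cTangent (M : Set CThree) (p : CThree) : Submodule ℂ CVector where
  carrier := {X | ∀ f : CThree → ℝ, AnalyticAt ℝ f p → (∀ᶠ q in 𝓝[M] p, f q = 0) →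
    X.deriv (fun q => (f q : ℂ)) p = 0}
  zero_mem' := by
    intro f _ _
    have h := CVector.deriv_smul 0 0 (fun q => (f q : ℂ)) p
    rwa [zero_smul, zero_mul] at h
  add_mem' := by
    intro X Y hX hY f hf h0
    rw [CVector.deriv_add, hX f hf h0, hY f hf h0, add_zero]
  smul_mem' := by
    intro c X hX f hf h0
    rw [CVector.deriv_smul, hX f hf h0, mul_zero]

/-- `T^{1,0}_p M`: the vectors `∑ aⱼ ∂/∂zⱼ` in `ℂ ⊗ T_p M`. -/
noncomputable def tangent10 (M : Set CThree) (p : CThree) : Submodule ℂ CVector :=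
  cTangent M p ⊓ LinearMap.ker (LinearMap.snd ℂ CThree CThree)

/-- `T^{0,1}_p M`: the vectors `∑ bⱼ ∂/∂z̄ⱼ` in `ℂ ⊗ T_p M`. -/
noncomputable def tangent01 (M : Set CThree) (p : CThree) : Submodule ℂ CVector :=
  cTangent M p ⊓ LinearMap.ker (LinearMap.fst ℂ CThree CThree)

/-- The conjugate of a complexified vector field. -/
noncomputable def cConj (X : CThree → CVector) : CThree → CVector :=
  fun q => (star (X q).2, star (X q).1)

/-- `L` is (the extension to a neighbourhood of `p` in `ℂ³` of) a smooth local section of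
`T^{1,0} M` near `p`. -/
def IsSection10 (M : Set CThree) (p : CThree) (L : CThree → CVector) : Prop :=
  ContDiffAt ℝ ∞ L p ∧ ∀ᶠ q in 𝓝[M] p, L q ∈ tangent10 M q

/-- `(L₁, L₂)` is a local frame of `T^{1,0} M` near `p`. -/
def IsFrame10 (M : Set CThree) (p : CThree) (L : Fin 2 → CThree → CVector) : Prop :=
  (∀ j, IsSection10 M p (L j)) ∧ LinearIndependent ℂ (fun j => L j p) ∧
    Submodule.span ℂ (Set.range fun j => L j p) = tangent10 M p

/-- The Levi matrix at `p` of the frame `L`, read through the linear form `ρ`: its `(j, k)` entry is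
`ρ (i [L_k, L̄_j])`. -/
noncomputable def leviMatrix (ρ : CVector →ₗ[ℂ] ℂ) (L : Fin 2 → CThree → CVector) (p : CThree) :
    Matrix (Fin 2) (Fin 2) ℂ :=
  Matrix.of fun j k => ρ (Complex.I • cBracket (L k) (cConj (L j)) p)

/-- The Levi form of `M` at `p`, i.e. the Hermitian form
`(L_p, K_p) ↦ i [L, K̄]_p mod T^{1,0}_p M ⊕ T^{0,1}_p M` on `T^{1,0}_p M`, has rank `n`.
The rank is that of its matrix in a local frame of `T^{1,0} M`, the one-dimensional quotient of
`ℂ ⊗ T_p M` by `T^{1,0}_p M ⊕ T^{0,1}_p M` being identified with `ℂ` by a linear form `ρ` whose kernel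
on `ℂ ⊗ T_p M` is that sum; it depends neither on the frame nor on `ρ`. -/
def HasLeviRank (M : Set CThree) (p : CThree) (n : ℕ) : Prop :=
  ∃ (L : Fin 2 → CThree → CVector) (ρ : CVector →ₗ[ℂ] ℂ), IsFrame10 M p L ∧
    (∀ X ∈ cTangent M p, (ρ X = 0 ↔ X ∈ tangent10 M p ⊔ tangent01 M p)) ∧
    (leviMatrix ρ L p).rank = n

/-- `Ψ`, defined near `p`, is a system of local holomorphic coordinates of `ℂ³` centred at `p`
(a biholomorphism between open sets that sends `p` to the origin). -/
def IsHolomorphicChartAt (Ψ : OpenPartialHomeomorph CThree CThree) (p : CThree) : Prop :=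
  p ∈ Ψ.source ∧ Ψ p = 0 ∧ DifferentiableOn ℂ Ψ Ψ.source ∧ DifferentiableOn ℂ Ψ.symm Ψ.target

/-- `R` is a convergent power series in independent variables `(z₁, z₂, z̄₁, z̄₂, u)`, of order at
least `3`, holomorphic on the polydisc of radius `δ`, real-valued when `z̄₁, z̄₂` are the conjugates
of `z₁, z₂` and `u` is real, and with
`0 ≡ R(0, 0, z̄₁, z̄₂, u) ≡ R(z₁, z₂, 0, 0, u)`. -/
structure IsNormalRemainder (R : ℂ × ℂ × ℂ × ℂ × ℂ → ℂ) (δ : ℝ) : Prop where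
  holomorphic : AnalyticOnNhd ℂ R (Metric.ball 0 δ)
  order_three : R =O[𝓝 0] fun x => ‖x‖ ^ 3
  real : ∀ (z₁ z₂ : ℂ) (u : ℝ), (z₁, z₂, conj z₁, conj z₂, (u : ℂ)) ∈
    Metric.ball (0 : ℂ × ℂ × ℂ × ℂ × ℂ) δ → (R (z₁, z₂, conj z₁, conj z₂, (u : ℂ))).im = 0
  zero_left : ∀ ζ₁ ζ₂ ν : ℂ, (0, 0, ζ₁, ζ₂, ν) ∈ Metric.ball (0 : ℂ × ℂ × ℂ × ℂ × ℂ) δ →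
    R (0, 0, ζ₁, ζ₂, ν) = 0
  zero_right : ∀ z₁ z₂ ν : ℂ, (z₁, z₂, 0, 0, ν) ∈ Metric.ball (0 : ℂ × ℂ × ℂ × ℂ × ℂ) δ →
    R (z₁, z₂, 0, 0, ν) = 0

-- Conjugate coordinates are treated as independent variables. Near `p` the hypersurface is `H (q,
-- q̄) = 0` with `H` holomorphic and Hermitian-symmetric, and after an affine change its
-- differential is `(w - τ) / 2i`, where `τ` stands for `w̄`. The pure terms are removed with Segre
-- varieties. The slice `z = 0` of `M` is a curve `w = s + i h(s)`, `s` real, and `w = W(z, s)`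
-- parametrizes the Segre varieties of its points. With `s` as new last coordinate, the points `((z,
-- s), (0, s))` satisfy the complexified equation. Solving that equation as `(s - σ) / 2i = F(z, ζ,
-- (s + σ) / 2)` therefore gives `F(z, 0, u) = 0`, and Hermitian symmetry gives `F(0, ζ, u) = 0`
-- (`exists_normal_form`, `IsRealAnalyticHypersurface.exists_normal_chart`).
--
-- Consequently `F` has no constant or linear part, and its Hessian reduces to the mixed block in
-- `z` and `ζ`, a Hermitian form on `ℂ²`. This block carries the Levi form: differentiating `dG(L) =
-- 0` along a conjugate field `K̄` tangent to `M` expresses the `(1,0)` part of `[L, K̄]` by the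
-- mixed Hessian of an equation `G` (`IsLocalEquation.fderiv_cBracket`). Levi rank 2 thus makes the
-- block nondegenerate (`HasLeviRank.normal_germ_nondegenerate`).
--
-- In a basis where the form is `diag(ε₀, ε₀ ε)`, and with the last coordinate multiplied by `ε₀`,
-- the quadratic part becomes `z₁ ζ₁ + ε z₂ ζ₂`. What is left has vanishing two-jet and still
-- vanishes for `z = 0` and for `ζ = 0`, because the quadratic part does
-- (`IsNormalGerm.exists_isNormalRemainder`).

attribute [fun_prop] analyticAt_fst analyticAt_snd

/-! ### Conjugation of holomorphic maps -/

theorem Prod.normedStarGroup {E F : Type*} [NormedAddCommGroup E] [StarAddMonoid E]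
    [NormedStarGroup E] [NormedAddCommGroup F] [StarAddMonoid F] [NormedStarGroup F] :
    NormedStarGroup (E × F) where
  norm_star_le x := by simp [Prod.norm_def]

section StarConjugate

variable {E F : Type*} [NormedAddCommGroup E] [NormedSpace ℂ E] [StarAddMonoid E]
  [NormedStarGroup E] [StarModule ℂ E] [NormedAddCommGroup F] [NormedSpace ℂ F]
  [StarAddMonoid F] [NormedStarGroup F] [StarModule ℂ F]

/-- The conjugate `(m₁, …, mₙ) ↦ star (f (star m₁, …, star mₙ))` of a multilinear map. -/
noncomputable def ContinuousMultilinearMap.starConj {n : ℕ}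
    (f : ContinuousMultilinearMap ℂ (fun _ : Fin n => E) F) :
    ContinuousMultilinearMap ℂ (fun _ : Fin n => E) F :=
  MultilinearMap.mkContinuous
    { toFun := fun m => star (f fun i => star (m i))
      map_update_add' := by
        intro _ m i x y
        have h : ∀ v : E, (fun j => star (Function.update m i v j)) =
            Function.update (fun j => star (m j)) i (star v) := by
          intro v; ext j; by_cases hj : j = i
          · subst hj; simp
          · simp [hj]
        simp only [h, star_add, f.map_update_add]
      map_update_smul' := by
        intro _ m i c x
        have h : ∀ v : E, (fun j => star (Function.update m i v j)) =
            Function.update (fun j => star (m j)) i (star v) := by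
          intro v; ext j; by_cases hj : j = i
          · subst hj; simp
          · simp [hj]
        simp only [h, star_smul, f.map_update_smul, star_star] }
    ‖f‖ (by
      intro m
      have := f.le_opNorm fun i => star (m i)
      simpa using this)

theorem ContinuousMultilinearMap.norm_starConj_le {n : ℕ}
    (f : ContinuousMultilinearMap ℂ (fun _ : Fin n => E) F) : ‖f.starConj‖ ≤ ‖f‖ :=
  MultilinearMap.mkContinuous_norm_le _ (norm_nonneg _) _

/-- Conjugating the coefficients of the power series does not increase their norms, so the radius of
convergence does not drop; conjugating the convergent sum term by term gives the value. -/
theorem AnalyticAt.star_star {f : E → F} {x : E} (hf : AnalyticAt ℂ f (star x)) :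
    AnalyticAt ℂ (fun y => star (f (star y))) x := by
  obtain ⟨p, r, hp⟩ := hf
  refine ⟨fun n => (p n).starConj, r, ?_, hp.r_pos, ?_⟩
  · refine hp.r_le.trans ?_
    refine ENNReal.le_of_forall_nnreal_lt fun s hs => ?_
    obtain ⟨C, -, hC⟩ := p.norm_mul_pow_le_of_lt_radius hs
    refine FormalMultilinearSeries.le_radius_of_bound _ C fun n => le_trans ?_ (hC n)
    gcongr
    exact (p n).norm_starConj_le
  · intro y hy
    have hy' : star y ∈ Metric.eball (0 : E) r := by
      simpa [edist_zero_right, enorm_eq_nnnorm, nnnorm_star] using hy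
    have h := (hp.hasSum hy').star
    rw [star_add]
    exact h

theorem fderiv_star_star_apply {f : E → F} {x : E} (hf : DifferentiableAt ℂ f (star x)) (v : E) :
    fderiv ℂ (fun y => star (f (star y))) x v = star (fderiv ℂ f (star x) (star v)) := by
  have h := hf.hasFDerivAt.star_star
  rw [_root_.star_star] at h
  have h' : fderiv ℂ (fun y => star (f (star y))) x = _ := h.fderiv
  rw [h']
  rfl

end StarConjugate

/-! ### Complexification of real power series -/

section Complexification

variable {ι : Type*} [Fintype ι]

/-- The complexification of a real multilinear form in coordinates. -/
noncomputable def ContinuousMultilinearMap.complexify {n : ℕ}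
    (f : ContinuousMultilinearMap ℝ (fun _ : Fin n => ι → ℝ) ℝ) :
    ContinuousMultilinearMap ℂ (fun _ : Fin n => ι → ℂ) ℂ :=
  open Classical in
  ∑ i : Fin n → ι, (f (fun j => Pi.single (i j) 1) : ℂ) •
    (ContinuousMultilinearMap.mkPiAlgebra ℂ (Fin n) ℂ).compContinuousLinearMap
      fun j => ContinuousLinearMap.proj (i j)

theorem ContinuousMultilinearMap.complexify_ofReal {n : ℕ}
    (f : ContinuousMultilinearMap ℝ (fun _ : Fin n => ι → ℝ) ℝ) (x : ι → ℝ) :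
    f.complexify (fun _ i => (x i : ℂ)) = (f fun _ => x : ℝ) := by
  classical
  have hx : x = ∑ i, x i • (Pi.single i 1 : ι → ℝ) := by
    ext j; simp [Finset.sum_apply, Pi.single_apply]
  conv_rhs => rw [hx, f.map_sum (fun (_ : Fin n) i => x i • (Pi.single i 1 : ι → ℝ))]
  rw [complexify, sum_apply]
  push_cast
  refine Finset.sum_congr rfl fun i _ => ?_
  rw [f.map_smul_univ (fun j => x (i j)) (fun j => Pi.single (i j) 1)]
  simp [mul_comm]

/-- There are `(card ι) ^ n` tuples of basis vectors, each contributing at most `‖f‖`. The loss is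
geometric in `n`, so it only shrinks the radius of convergence. -/
theorem ContinuousMultilinearMap.norm_complexify_le {n : ℕ}
    (f : ContinuousMultilinearMap ℝ (fun _ : Fin n => ι → ℝ) ℝ) :
    ‖f.complexify‖ ≤ (Fintype.card ι : ℝ) ^ n * ‖f‖ := by
  classical
  have key : ∀ i : Fin n → ι, ‖(f (fun j => Pi.single (i j) 1) : ℂ) •
      (ContinuousMultilinearMap.mkPiAlgebra ℂ (Fin n) ℂ).compContinuousLinearMap
      (fun j => (ContinuousLinearMap.proj (i j) : (ι → ℂ) →L[ℂ] ℂ))‖ ≤ ‖f‖ := by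
    intro i
    rw [norm_smul]
    have h1 : ‖(f (fun j => Pi.single (i j) 1) : ℂ)‖ ≤ ‖f‖ := by
      rw [Complex.norm_real]
      refine (f.le_opNorm _).trans ?_
      have : ∏ j, ‖(Pi.single (i j) 1 : ι → ℝ)‖ ≤ 1 :=
        Finset.prod_le_one (fun _ _ => norm_nonneg _) fun j _ => by simp [Pi.norm_single]
      nlinarith [norm_nonneg f]
    have h2 : ‖(ContinuousMultilinearMap.mkPiAlgebra ℂ (Fin n) ℂ).compContinuousLinearMap
        (fun j => (ContinuousLinearMap.proj (i j) : (ι → ℂ) →L[ℂ] ℂ))‖ ≤ 1 := by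
      refine (ContinuousMultilinearMap.norm_compContinuousLinearMap_le _ _).trans ?_
      rw [ContinuousMultilinearMap.norm_mkPiAlgebra, one_mul]
      refine Finset.prod_le_one (fun _ _ => norm_nonneg _) fun j _ => ?_
      exact ContinuousLinearMap.opNorm_le_bound _ zero_le_one fun x => by
        simpa using norm_le_pi_norm x (i j)
    calc _ ≤ ‖f‖ * 1 := mul_le_mul h1 h2 (norm_nonneg _) (norm_nonneg _)
      _ = ‖f‖ := mul_one _
  have := (norm_sum_le _ _).trans (Finset.sum_le_sum fun i (_ : i ∈ Finset.univ) => key i)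
  simpa [complexify] using this

/-- A real-analytic function in real coordinates extends to a holomorphic one. -/
theorem AnalyticAt.exists_complexification {f : (ι → ℝ) → ℝ} (hf : AnalyticAt ℝ f 0) :
    ∃ g : (ι → ℂ) → ℂ, AnalyticAt ℂ g 0 ∧ ∀ᶠ x in 𝓝 (0 : ι → ℝ), g (fun i => (x i : ℂ)) = f x := by
  obtain ⟨p, r, hp⟩ := hf
  set P : FormalMultilinearSeries ℂ (ι → ℂ) ℂ := fun n => (p n).complexify with hP
  have hrad : 0 < P.radius := by
    obtain ⟨s, hs0, hs⟩ := ENNReal.lt_iff_exists_nnreal_btwn.1 (hp.r_pos.trans_le hp.r_le)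
    have hs0' : 0 < s := by exact_mod_cast hs0
    obtain ⟨C, -, hC⟩ := p.norm_mul_pow_le_of_lt_radius hs
    -- The norm bound loses a factor `card ι` per degree, hence the radius is divided by it; the `+
    -- 1` keeps the divisor positive when `ι` is empty.
    set m : NNReal := Fintype.card ι + 1
    have hm : 0 < m := by positivity
    have : ((s / m : NNReal) : ENNReal) ≤ P.radius := by
      refine P.le_radius_of_bound C fun n => le_trans ?_ (hC n)
      have h1 : ‖P n‖ ≤ (m : ℝ) ^ n * ‖p n‖ := by
        refine (p n).norm_complexify_le.trans ?_
        gcongr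
        simp [m]
      have hm' : (m : ℝ) ≠ 0 := by positivity
      calc ‖P n‖ * ((s / m : NNReal) : ℝ) ^ n
          ≤ ((m : ℝ) ^ n * ‖p n‖) * ((s / m : NNReal) : ℝ) ^ n := by gcongr
        _ = ‖p n‖ * (s : ℝ) ^ n := by
          push_cast
          rw [div_pow]
          field_simp
    refine lt_of_lt_of_le ?_ this
    exact_mod_cast div_pos hs0' hm
  have hg := P.hasFPowerSeriesOnBall hrad
  refine ⟨P.sum, hg.analyticAt, ?_⟩
  have hcont : Continuous fun x : ι → ℝ => (fun i => (x i : ℂ) : ι → ℂ) := by fun_prop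
  have e1 : ∀ᶠ x in 𝓝 (0 : ι → ℝ), (fun i => (x i : ℂ) : ι → ℂ) ∈ Metric.eball (0 : ι → ℂ) P.radius :=
    hcont.continuousAt.eventually_mem (by
      have : (fun i => ((0 : ι → ℝ) i : ℂ) : ι → ℂ) = 0 := by ext; simp
      rw [this]; exact Metric.eball_mem_nhds _ hrad)
  filter_upwards [e1, Metric.eball_mem_nhds _ hp.r_pos] with x hx1 hx2
  have h1 := hg.hasSum hx1
  have h2 := (hp.hasSum hx2).mapL Complex.ofRealCLM
  rw [zero_add] at h1 h2
  simp only [hP, ContinuousMultilinearMap.complexify_ofReal] at h1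
  exact h1.unique h2

end Complexification

/-! ### Implicit functions and composition at the origin -/

section Implicit

variable {V : Type*} [NormedAddCommGroup V] [NormedSpace ℂ V] [CompleteSpace V]

/-- The holomorphic implicit function theorem for one scalar equation. -/
theorem AnalyticAt.exists_implicit {G : V × ℂ → ℂ} (hG : AnalyticAt ℂ G 0) (h0 : G 0 = 0)
    (hd : fderiv ℂ G 0 (0, 1) ≠ 0) :
    ∃ f : V → ℂ, AnalyticAt ℂ f 0 ∧ f 0 = 0 ∧ (∀ᶠ x in 𝓝 0, G (x, f x) = 0) ∧
      ∀ᶠ y in 𝓝 (0 : V × ℂ), G y = 0 ↔ f y.1 = y.2 := by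
  have cdf : ContDiffAt ℂ ω G 0 := hG.contDiffAt
  have hinv : (fderiv ℂ G 0 ∘L .inr ℂ V ℂ).IsInvertible := by
    refine ⟨ContinuousLinearEquiv.unitsEquivAut ℂ (.mk0 _ hd), ?_⟩
    ext
    simp
  refine ⟨cdf.implicitFunction (by simp) hinv, (cdf.contDiffAt_implicitFunction (by simp) hinv).analyticAt,
    cdf.implicitFunction_apply_self (by simp) hinv, ?_, ?_⟩
  · simpa [h0] using cdf.eventually_apply_implicitFunction (by simp) hinv
  · simpa [h0] using cdf.eventually_apply_eq_iff_implicitFunction (by simp) hinv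

end Implicit

theorem Filter.Eventually.comp_continuousAt_zero {A B : Type*} [TopologicalSpace A] [Zero A]
    [TopologicalSpace B] [Zero B] {P : B → Prop} (h : ∀ᶠ y in 𝓝 0, P y) {φ : A → B}
    (hφ : ContinuousAt φ 0) (h0 : φ 0 = 0) : ∀ᶠ x in 𝓝 0, P (φ x) :=
  hφ.eventually (by rwa [h0])

theorem fderiv_comp_zero_apply {A B C : Type*} [NormedAddCommGroup A] [NormedSpace ℂ A]
    [NormedAddCommGroup B] [NormedSpace ℂ B] [NormedAddCommGroup C] [NormedSpace ℂ C]
    {H : B → C} {φ : A → B} {L : A →L[ℂ] B} (hH : DifferentiableAt ℂ H 0)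
    (hφ : HasFDerivAt φ L 0) (h0 : φ 0 = 0) (v : A) :
    fderiv ℂ (fun x => H (φ x)) 0 v = fderiv ℂ H 0 (L v) := by
  have h1 : HasFDerivAt H (fderiv ℂ H 0) (φ 0) := by rw [h0]; exact hH.hasFDerivAt
  have h2 : HasFDerivAt (fun x => H (φ x)) ((fderiv ℂ H 0).comp L) 0 := h1.comp 0 hφ
  rw [h2.fderiv]; rfl

set_option linter.unusedSectionVars false

/-! ### Removal of the pure terms by Segre varieties -/

section NormalForm

variable {E : Type*} [NormedAddCommGroup E] [NormedSpace ℂ E] [CompleteSpace E]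
  [StarAddMonoid E] [NormedStarGroup E] [StarModule ℂ E]

/-- A Hermitian defining equation `H = 0` with differential `(w - τ) / 2i` at the origin: the pure
part of `H` along `z = 0` is straightened. -/
theorem exists_real_axis {H : (E × ℂ) × (E × ℂ) → ℂ} (hH : AnalyticAt ℂ H 0) (h0 : H 0 = 0)
    (hherm : ∀ᶠ y in 𝓝 (0 : (E × ℂ) × (E × ℂ)), star (H (star y.2, star y.1)) = H y)
    (hd : ∀ y, fderiv ℂ H 0 y = (y.1.2 - y.2.2) / (2 * Complex.I)) :
    ∃ h : ℂ → ℂ, AnalyticAt ℂ h 0 ∧ h 0 = 0 ∧ fderiv ℂ h 0 1 = 0 ∧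
      (∀ᶠ s in 𝓝 (0 : ℂ), star (h (star s)) = h s) ∧
      ∀ᶠ s in 𝓝 (0 : ℂ), H ((0, s + Complex.I * h s), (0, s - Complex.I * h s)) = 0 := by
  have h0' : H ((0, 0), (0, 0)) = 0 := h0
  set G : ℂ × ℂ → ℂ := fun x => H ((0, x.1 + Complex.I * x.2), (0, x.1 - Complex.I * x.2)) with hG
  have hGa : AnalyticAt ℂ G 0 := by
    refine AnalyticAt.comp_of_eq (g := H) (f := fun x : ℂ × ℂ => (((0 : E), x.1 + Complex.I * x.2),
      ((0 : E), x.1 - Complex.I * x.2))) (y := 0) hH (by fun_prop) (by simp)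
  have hG0 : G 0 = 0 := by simp [hG, h0']
  set L : ℂ × ℂ →L[ℂ] (E × ℂ) × (E × ℂ) :=
    ((0 : ℂ × ℂ →L[ℂ] E).prod (.fst ℂ ℂ ℂ + Complex.I • .snd ℂ ℂ ℂ)).prod
      ((0 : ℂ × ℂ →L[ℂ] E).prod (.fst ℂ ℂ ℂ - Complex.I • .snd ℂ ℂ ℂ)) with hLdef
  have hL : HasFDerivAt (fun x : ℂ × ℂ => (((0 : E), x.1 + Complex.I * x.2),
      ((0 : E), x.1 - Complex.I * x.2))) L 0 := L.hasFDerivAt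
  have hGd : fderiv ℂ G 0 (0, 1) ≠ 0 := by
    rw [hG, fderiv_comp_zero_apply hH.differentiableAt hL (by simp), hd]
    simp [hLdef]
  obtain ⟨h, ha, hz, hs, hu⟩ := hGa.exists_implicit hG0 hGd
  refine ⟨h, ha, hz, ?_, ?_, hs⟩
  · have h1 : HasFDerivAt (fun s => (s, h s)) ((ContinuousLinearMap.id ℂ ℂ).prod (fderiv ℂ h 0)) 0 :=
      (hasFDerivAt_id _).prodMk ha.differentiableAt.hasFDerivAt
    have h2 := fderiv_comp_zero_apply hGa.differentiableAt h1 (by simp [hz]) 1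
    rw [Filter.EventuallyEq.fderiv_eq (f₁ := fun s => G (s, h s)) (f := fun _ => 0) hs, hG,
      fderiv_comp_zero_apply hH.differentiableAt hL (by simp), hd] at h2
    simpa [hLdef] using h2.symm
  · have hc : ContinuousAt h 0 := ha.continuousAt
    have hc' : ContinuousAt (fun s => star (h (star s))) 0 := by
      have : ContinuousAt h (star 0) := by simpa using hc
      exact continuous_star.continuousAt.comp (ContinuousAt.comp this continuous_star.continuousAt)
    -- By Hermitian symmetry `s ↦ star (h (star s))` solves the same implicit equation, so it equals
    -- `h` by uniqueness.
    have e1 := hu.comp_continuousAt_zero (φ := fun s : ℂ => (s, star (h (star s))))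
      (continuousAt_id.prodMk hc') (by simp [hz])
    have e2 := hs.comp_continuousAt_zero (φ := fun s : ℂ => star s) 
      continuous_star.continuousAt (by simp)
    have e3 := hherm.comp_continuousAt_zero (φ := fun s : ℂ => (((0 : E), s + Complex.I * star (h (star s))),
      ((0 : E), s - Complex.I * star (h (star s))))) (by fun_prop) (by simp [hz])
    filter_upwards [e1, e2, e3] with s h1 h2 h3
    refine (h1.1 ?_).symm
    simp only [hG] at h2 ⊢
    rw [← h3]
    simpa [Prod.star_def, sub_eq_add_neg] using h2

/-- The graph parametrization `w = W (z, s)` of the Segre varieties of the points of the straightened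
axis. -/
theorem exists_segre_parametrization {H : (E × ℂ) × (E × ℂ) → ℂ} (hH : AnalyticAt ℂ H 0)
    (h0 : H 0 = 0)
    (hherm : ∀ᶠ y in 𝓝 (0 : (E × ℂ) × (E × ℂ)), star (H (star y.2, star y.1)) = H y)
    (hd : ∀ y, fderiv ℂ H 0 y = (y.1.2 - y.2.2) / (2 * Complex.I)) :
    ∃ W : E × ℂ → ℂ, AnalyticAt ℂ W 0 ∧ W 0 = 0 ∧ (∀ y, fderiv ℂ W 0 y = y.2) ∧
      ∀ᶠ x in 𝓝 (0 : E × ℂ), H ((x.1, W x), (0, star (W (0, star x.2)))) = 0 := by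
  have h0' : H ((0, 0), (0, 0)) = 0 := h0
  obtain ⟨h, ha, hz, hh', hsymm, hs⟩ := exists_real_axis hH h0 hherm hd
  set φ : (E × ℂ) × ℂ → (E × ℂ) × (E × ℂ) :=
    fun x => ((x.1.1, x.2), ((0 : E), x.1.2 - Complex.I * h x.1.2)) with hφdef
  have hφ0 : φ 0 = 0 := by simp [hφdef, hz]
  have hφa : AnalyticAt ℂ φ 0 := by
    have : AnalyticAt ℂ h (0 : (E × ℂ) × ℂ).1.2 := ha
    fun_prop
  have hfd : fderiv ℂ h 0 = 0 := by ext; simpa using hh'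
  have hLa : ∀ v, fderiv ℂ φ 0 v = ((v.1.1, v.2), (0, v.1.2)) := by
    intro v
    set π : (E × ℂ) × ℂ →L[ℂ] ℂ := (ContinuousLinearMap.snd ℂ E ℂ).comp (.fst ℂ (E × ℂ) ℂ)
    have hh0 : HasFDerivAt h (0 : ℂ →L[ℂ] ℂ) (π 0) := by
      rw [map_zero, ← hfd]; exact ha.differentiableAt.hasFDerivAt
    have h1 : HasFDerivAt (fun x : (E × ℂ) × ℂ => h x.1.2) ((0 : ℂ →L[ℂ] ℂ).comp π) 0 :=
      hh0.comp 0 π.hasFDerivAt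
    have h2 := (((((ContinuousLinearMap.fst ℂ E ℂ).comp (.fst ℂ (E × ℂ) ℂ)).prod
      (.snd ℂ (E × ℂ) ℂ)).hasFDerivAt (x := 0)).prodMk
      ((hasFDerivAt_const (0 : E) (0 : (E × ℂ) × ℂ)).prodMk
        ((π.hasFDerivAt (x := 0)).sub (h1.const_mul Complex.I))))
    have h3 : HasFDerivAt φ _ 0 := h2
    rw [h3.fderiv]
    simp [π]
  set G : (E × ℂ) × ℂ → ℂ := fun x => H (φ x) with hG
  have hGa : AnalyticAt ℂ G 0 := AnalyticAt.comp_of_eq (g := H) hH hφa hφ0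
  have hG0 : G 0 = 0 := by simp [hG, hφ0, h0]
  have hGd' : ∀ v, fderiv ℂ G 0 v = (v.2 - v.1.2) / (2 * Complex.I) := by
    intro v
    rw [hG, fderiv_comp_zero_apply hH.differentiableAt hφa.differentiableAt.hasFDerivAt hφ0, hd, hLa]
  obtain ⟨W, hW, hW0, hWs, hWu⟩ := hGa.exists_implicit hG0 (by simp [hGd'])
  refine ⟨W, hW, hW0, ?_, ?_⟩
  · intro y
    have h1 : HasFDerivAt (fun x => (x, W x)) ((ContinuousLinearMap.id ℂ (E × ℂ)).prod
        (fderiv ℂ W 0)) 0 := (hasFDerivAt_id _).prodMk hW.differentiableAt.hasFDerivAt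
    have h2 := fderiv_comp_zero_apply hGa.differentiableAt h1 (by simp [hW0]) y
    rw [Filter.EventuallyEq.fderiv_eq (f₁ := fun s => G (s, W s)) (f := fun _ => 0) hWs, hGd'] at h2
    simpa [sub_eq_zero] using h2.symm
  · have hc : ContinuousAt h 0 := ha.continuousAt
    have e1 := hWu.comp_continuousAt_zero (φ := fun s : ℂ => (((0 : E), s), s + Complex.I * h s))
      (by fun_prop) (by simp [hz])
    -- On `z = 0` both sides solve the equation that defines `W`: each Segre variety passes through
    -- its own point of the axis.
    have e2 : ∀ᶠ s in 𝓝 (0 : ℂ), W (0, s) = s + Complex.I * h s := by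
      filter_upwards [e1, hs] with s h1 h2
      exact h1.1 h2
    have e3 := e2.comp_continuousAt_zero (φ := fun x : E × ℂ => star x.2) (by fun_prop) (by simp)
    have e4 := hsymm.comp_continuousAt_zero (φ := fun x : E × ℂ => x.2) (by fun_prop) (by simp)
    filter_upwards [hWs, e3, e4] with x h1 h3 h4
    rw [h3]
    simp only [hG, hφdef] at h1
    have : star (star x.2 + Complex.I * h (star x.2)) = x.2 - Complex.I * h x.2 := by
      rw [← h4]; simp [sub_eq_add_neg]
    rw [this, h1]

/-- A Hermitian analytic equation `H = 0` with differential `(w - τ) / 2i` at the origin takes, after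
a change of the last coordinate, the form `(s - σ) / 2i = F (z, ζ, (s + σ) / 2)` with `F` vanishing
for `z = 0` and for `ζ = 0`. -/
theorem exists_normal_form {H : (E × ℂ) × (E × ℂ) → ℂ} (hH : AnalyticAt ℂ H 0)
    (h0 : H 0 = 0)
    (hherm : ∀ᶠ y in 𝓝 (0 : (E × ℂ) × (E × ℂ)), star (H (star y.2, star y.1)) = H y)
    (hd : ∀ y, fderiv ℂ H 0 y = (y.1.2 - y.2.2) / (2 * Complex.I)) :
    ∃ (W : E × ℂ → ℂ) (F : E × E × ℂ → ℂ), AnalyticAt ℂ W 0 ∧ W 0 = 0 ∧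
      (∀ y, fderiv ℂ W 0 y = y.2) ∧ AnalyticAt ℂ F 0 ∧
      (∀ᶠ x in 𝓝 (0 : E × ℂ), F (x.1, 0, x.2) = 0) ∧
      (∀ᶠ x in 𝓝 (0 : E × ℂ), F (0, x.1, x.2) = 0) ∧
      (∀ᶠ y in 𝓝 (0 : E × E × ℂ), star (F (star y.2.1, star y.1, star y.2.2)) = F y) ∧
      ∀ᶠ y in 𝓝 (0 : (E × ℂ) × (E × ℂ)), H ((y.1.1, W y.1), (y.2.1, star (W (star y.2)))) = 0 ↔
        F (y.1.1, y.2.1, (y.1.2 + y.2.2) / 2) = (y.1.2 - y.2.2) / (2 * Complex.I) := by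
  have : NormedStarGroup (E × ℂ) := Prod.normedStarGroup
  obtain ⟨W, hW, hW0, hWd, hWs⟩ := exists_segre_parametrization hH h0 hherm hd
  have hsW : AnalyticAt ℂ (fun x => star (W (star x))) 0 := AnalyticAt.star_star (by simpa using hW)
  have hsWd : ∀ y, fderiv ℂ (fun x => star (W (star x))) 0 y = y.2 := by
    intro y
    rw [fderiv_star_star_apply (by simpa using hW.differentiableAt)]
    simp [hWd]
  set φ : (E × ℂ) × (E × ℂ) → (E × ℂ) × (E × ℂ) :=
    fun y => ((y.1.1, W y.1), (y.2.1, star (W (star y.2)))) with hφdef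
  have hφ0 : φ 0 = 0 := by simp [hφdef, hW0]
  have hφa : AnalyticAt ℂ φ 0 := by
    have h1 : AnalyticAt ℂ W (0 : (E × ℂ) × (E × ℂ)).1 := hW
    have h2 : AnalyticAt ℂ (fun y : (E × ℂ) × (E × ℂ) => star (W (star y.2))) 0 :=
      AnalyticAt.comp_of_eq (g := fun x => star (W (star x))) hsW analyticAt_snd rfl
    fun_prop
  set H₁ : (E × ℂ) × (E × ℂ) → ℂ := fun y => H (φ y) with hH₁
  have hH₁a : AnalyticAt ℂ H₁ 0 := AnalyticAt.comp_of_eq (g := H) hH hφa hφ0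
  have hH₁0 : H₁ 0 = 0 := by simp [hH₁, hφ0, h0]
  have hφd : ∀ y, (fderiv ℂ φ 0 y).1.2 = y.1.2 ∧ (fderiv ℂ φ 0 y).2.2 = y.2.2 := by
    intro y
    set π₁ : (E × ℂ) × (E × ℂ) →L[ℂ] E × ℂ := .fst ℂ (E × ℂ) (E × ℂ)
    set π₂ : (E × ℂ) × (E × ℂ) →L[ℂ] E × ℂ := .snd ℂ (E × ℂ) (E × ℂ)
    have h1 : HasFDerivAt (fun y : (E × ℂ) × (E × ℂ) => W y.1) ((fderiv ℂ W 0).comp π₁) 0 :=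
      HasFDerivAt.comp (g := W) 0 hW.differentiableAt.hasFDerivAt π₁.hasFDerivAt
    have h2 : HasFDerivAt (fun y : (E × ℂ) × (E × ℂ) => star (W (star y.2)))
        ((fderiv ℂ (fun x => star (W (star x))) 0).comp π₂) 0 :=
      HasFDerivAt.comp (g := fun x => star (W (star x))) 0 hsW.differentiableAt.hasFDerivAt
        π₂.hasFDerivAt
    have h3 : HasFDerivAt φ _ 0 :=
      ((((ContinuousLinearMap.fst ℂ E ℂ).comp π₁).hasFDerivAt (x := 0)).prodMk h1).prodMk
        ((((ContinuousLinearMap.fst ℂ E ℂ).comp π₂).hasFDerivAt (x := 0)).prodMk h2)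
    rw [h3.fderiv]
    exact ⟨hWd _, hsWd _⟩
  have hH₁d : ∀ y, fderiv ℂ H₁ 0 y = (y.1.2 - y.2.2) / (2 * Complex.I) := by
    intro y
    rw [hH₁, fderiv_comp_zero_apply hH.differentiableAt hφa.differentiableAt.hasFDerivAt hφ0, hd,
      (hφd y).1, (hφd y).2]
  have hH₁h : ∀ᶠ y in 𝓝 (0 : (E × ℂ) × (E × ℂ)), star (H₁ (star y.2, star y.1)) = H₁ y := by
    filter_upwards [hherm.comp_continuousAt_zero hφa.continuousAt hφ0] with y hy
    simp only [hH₁]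
    rw [← hy]
    simp [hφdef, Prod.star_def]
  -- The defining property of `W` in the new coordinates; it becomes `F (z, 0, u) = 0` below.
  have hH₁z : ∀ᶠ x in 𝓝 (0 : E × ℂ), H₁ (x, (0, x.2)) = 0 := by
    filter_upwards [hWs] with x hx
    simp only [hH₁, hφdef]
    rw [← hx, Prod.star_def]
    simp
  set ν : (E × E × ℂ) × ℂ →L[ℂ] ℂ :=
    (ContinuousLinearMap.snd ℂ E ℂ).comp ((ContinuousLinearMap.snd ℂ E (E × ℂ)).comp (.fst ℂ _ ℂ))
  -- Substitutes `s = ν + i x` and `σ = ν - i x`; the equation is then solved for `x`, the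
  -- complexified imaginary part.
  set L : (E × E × ℂ) × ℂ →L[ℂ] (E × ℂ) × (E × ℂ) :=
    (((ContinuousLinearMap.fst ℂ E (E × ℂ)).comp (.fst ℂ _ ℂ)).prod
      (ν + Complex.I • .snd ℂ _ ℂ)).prod
    (((ContinuousLinearMap.fst ℂ E ℂ).comp ((ContinuousLinearMap.snd ℂ E (E × ℂ)).comp
      (.fst ℂ _ ℂ))).prod (ν - Complex.I • .snd ℂ _ ℂ))
  have hL : ∀ x, L x = ((x.1.1, x.1.2.2 + Complex.I * x.2),
      (x.1.2.1, x.1.2.2 - Complex.I * x.2)) := fun _ => rfl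
  set G : (E × E × ℂ) × ℂ → ℂ := fun x => H₁ (L x) with hG
  have hGa : AnalyticAt ℂ G 0 :=
    AnalyticAt.comp_of_eq (g := H₁) hH₁a (L.analyticAt 0) (map_zero L)
  have hG0 : G 0 = 0 := by simp [hG, hH₁0]
  have hGd : fderiv ℂ G 0 (0, 1) ≠ 0 := by
    rw [hG, fderiv_comp_zero_apply hH₁a.differentiableAt L.hasFDerivAt (map_zero L), hH₁d]
    simp [hL]
  obtain ⟨F, hF, hF0, hFs, hFu⟩ := hGa.exists_implicit hG0 hGd
  have hFr : ∀ᶠ x in 𝓝 (0 : E × ℂ), F (x.1, 0, x.2) = 0 := by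
    have e1 := hFu.comp_continuousAt_zero (φ := fun x : E × ℂ => ((x.1, (0 : E), x.2), (0 : ℂ)))
      (by fun_prop) (by simp)
    filter_upwards [e1, hH₁z] with x h1 h2
    refine h1.1 ?_
    simpa [hG, hL] using h2
  have hFh : ∀ᶠ y in 𝓝 (0 : E × E × ℂ), star (F (star y.2.1, star y.1, star y.2.2)) = F y := by
    have hc : Continuous fun y : E × E × ℂ => (star y.2.1, star y.1, star y.2.2) := by fun_prop
    have hFc : ContinuousAt (fun y : E × E × ℂ => F (star y.2.1, star y.1, star y.2.2)) 0 :=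
      ContinuousAt.comp_of_eq (g := F) hF.continuousAt hc.continuousAt (by simp)
    have hF0' : F (0, 0, 0) = 0 := hF0
    have hsFc : ContinuousAt (fun y : E × E × ℂ => star (F (star y.2.1, star y.1, star y.2.2))) 0 :=
      continuous_star.continuousAt.comp hFc
    have e1 := hFu.comp_continuousAt_zero
      (φ := fun y : E × E × ℂ => (y, star (F (star y.2.1, star y.1, star y.2.2))))
      (by fun_prop) (by simp [hF0'])
    have e2 := hFs.comp_continuousAt_zero hc.continuousAt (by simp)
    have e3 := hH₁h.comp_continuousAt_zero
      (φ := fun y : E × E × ℂ => L (y, star (F (star y.2.1, star y.1, star y.2.2))))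
      (by fun_prop) (by simp [hF0', hL])
    filter_upwards [e1, e2, e3] with y h1 h2 h3
    refine (h1.1 ?_).symm
    simp only [hG, hL] at h2 h3 ⊢
    rw [← h3]
    simpa [Prod.star_def, sub_eq_add_neg] using h2
  refine ⟨W, F, hW, hW0, hWd, hF, hFr, ?_, hFh, ?_⟩
  -- Hermitian symmetry exchanges `z` and `ζ`, so vanishing for `ζ = 0` transfers to `z = 0`.
  · have e1 := hFr.comp_continuousAt_zero (φ := fun x : E × ℂ => star x) (by fun_prop) (by simp)
    have e2 := hFh.comp_continuousAt_zero (φ := fun x : E × ℂ => ((0 : E), x.1, x.2))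
      (by fun_prop) (by simp)
    filter_upwards [e1, e2] with x h1 h2
    rw [← h2]
    simpa [Prod.star_def] using h1
  · have e1 := hFu.comp_continuousAt_zero (φ := fun y : (E × ℂ) × (E × ℂ) =>
      ((y.1.1, y.2.1, (y.1.2 + y.2.2) / 2), (y.1.2 - y.2.2) / (2 * Complex.I)))
      (by fun_prop) (by simp)
    filter_upwards [e1] with y h1
    rw [← h1]
    simp only [hG, hL]
    have h2 : (y.1.2 + y.2.2) / 2 + Complex.I * ((y.1.2 - y.2.2) / (2 * Complex.I)) = y.1.2 := by
      field_simp; ring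
    have h3 : (y.1.2 + y.2.2) / 2 - Complex.I * ((y.1.2 - y.2.2) / (2 * Complex.I)) = y.2.2 := by
      field_simp; ring
    rw [h2, h3]

end NormalForm

/-! ### Restriction to the totally real diagonal -/

section Diagonal

variable {F : Type*} [NormedAddCommGroup F] [NormedSpace ℂ F]

/-- The real derivative of the restriction of a holomorphic map to the totally real diagonal. -/
theorem hasFDerivAt_diagonal {T : CThree × CThree → F} {p : CThree}
    (hT : DifferentiableAt ℂ T (p, star p)) :
    HasFDerivAt (fun q => T (q, star q))
      (((fderiv ℂ T (p, star p)).restrictScalars ℝ).comp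
        ((ContinuousLinearMap.id ℝ CThree).prod
          ((starL' ℝ : CThree ≃L[ℝ] CThree) : CThree →L[ℝ] CThree))) p := by
  have h1 : HasFDerivAt (fun q : CThree => (q, star q))
      ((ContinuousLinearMap.id ℝ CThree).prod
          ((starL' ℝ : CThree ≃L[ℝ] CThree) : CThree →L[ℝ] CThree)) p :=
    (hasFDerivAt_id p).prodMk (starL' ℝ : CThree ≃L[ℝ] CThree).hasFDerivAt
  exact HasFDerivAt.comp (g := T) p (hT.hasFDerivAt.restrictScalars ℝ) h1

theorem fderiv_diagonal_apply {T : CThree × CThree → F} {p : CThree}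
    (hT : DifferentiableAt ℂ T (p, star p)) (v : CThree) :
    fderiv ℝ (fun q => T (q, star q)) p v = fderiv ℂ T (p, star p) (v, star v) := by
  rw [(hasFDerivAt_diagonal hT).fderiv]
  rfl

/-- If `H` is real on the diagonal, then its antiholomorphic differential is the conjugate of its
holomorphic one. -/
theorem fderiv_of_real_diagonal {H : CThree × CThree → ℂ} {p : CThree}
    (hH : DifferentiableAt ℂ H (p, star p)) (hreal : ∀ᶠ q in 𝓝 p, (H (q, star q)).im = 0)
    (b : CThree) :
    fderiv ℂ H (p, star p) (0, b) = star (fderiv ℂ H (p, star p) (star b, 0)) := by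
  set D := fderiv ℂ H (p, star p)
  have him : ∀ v, (D (v, star v)).im = 0 := by
    intro v
    have h1 := (Complex.imCLM.hasFDerivAt.comp p (hasFDerivAt_diagonal hH)).fderiv
    have h2 : fderiv ℝ (Complex.imCLM ∘ fun q => H (q, star q)) p = 0 := by
      have h3 : (Complex.imCLM ∘ fun q => H (q, star q)) =ᶠ[𝓝 p] fun _ => (0 : ℝ) := hreal
      rw [h3.fderiv_eq]
      simp
    rw [h2] at h1
    exact (congrArg (fun A : CThree →L[ℝ] ℝ => A v) h1).symm
  have hsplit : ∀ v, D (v, star v) = D (v, 0) + D (0, star v) := by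
    intro v; rw [← map_add]; simp
  -- Reality along the vectors `star b` and `i • star b` determines the imaginary and the real part
  -- of the identity.
  have h1 := him (star b)
  have h2 := him (Complex.I • star b)
  rw [hsplit, star_star] at h1
  rw [hsplit, star_smul, star_star] at h2
  have e1 : D (Complex.I • star b, 0) = Complex.I * D (star b, 0) := by
    rw [← smul_eq_mul, ← map_smul]; simp
  have e2 : D (0, star Complex.I • b) = -Complex.I * D (0, b) := by
    rw [← smul_eq_mul, ← map_smul]; simp
  rw [e1, e2] at h2
  apply Complex.ext <;> simp at h1 h2 ⊢ <;> linarith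

end Diagonal

/-! ### Polarization and normal charts -/

/-- A real-analytic function on `ℂ³` extends to a holomorphic function of `q` and `q̄`. -/
theorem exists_polarization {r : CThree → ℝ} {p : CThree} (hr : AnalyticAt ℝ r p) :
    ∃ H : CThree × CThree → ℂ, AnalyticAt ℂ H (p, star p) ∧
      ∀ᶠ q in 𝓝 p, H (q, star q) = r q := by
  let A : (Fin 6 → ℝ) →ₗ[ℝ] CThree :=
    { toFun := fun x => (⟨x 0, x 1⟩, ⟨x 2, x 3⟩, ⟨x 4, x 5⟩)
      map_add' := fun x y => by ext <;> apply Complex.ext <;> simp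
      map_smul' := fun c x => by ext <;> apply Complex.ext <;> simp }
  let A' : (Fin 6 → ℝ) →L[ℝ] CThree := A.toContinuousLinearMap
  -- The real and imaginary parts of `q - p`, written through `q` and `q̄` and then extended to
  -- independent variables.
  let C : CThree × CThree → Fin 6 → ℂ := fun y =>
    ![(y.1.1 - p.1 + (y.2.1 - star p.1)) / 2, (y.1.1 - p.1 - (y.2.1 - star p.1)) / (2 * Complex.I),
      (y.1.2.1 - p.2.1 + (y.2.2.1 - star p.2.1)) / 2,
      (y.1.2.1 - p.2.1 - (y.2.2.1 - star p.2.1)) / (2 * Complex.I),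
      (y.1.2.2 - p.2.2 + (y.2.2.2 - star p.2.2)) / 2,
      (y.1.2.2 - p.2.2 - (y.2.2.2 - star p.2.2)) / (2 * Complex.I)]
  have hf : AnalyticAt ℝ (fun x => r (p + A' x)) 0 :=
    AnalyticAt.comp_of_eq (g := r) hr (analyticAt_const.add (A'.analyticAt 0)) (by simp)
  obtain ⟨g, hg, hgr⟩ := hf.exists_complexification
  have hC : AnalyticAt ℂ C (p, star p) := by
    rw [analyticAt_pi_iff]
    intro i
    fin_cases i <;> simp <;> fun_prop (disch := simp)
  have hC0 : C (p, star p) = 0 := by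
    ext i; fin_cases i <;> simp [C]
  refine ⟨fun y => g (C y), AnalyticAt.comp_of_eq (g := g) hg hC hC0, ?_⟩
  let D : CThree → Fin 6 → ℝ := fun q => ![(q.1 - p.1).re, (q.1 - p.1).im, (q.2.1 - p.2.1).re,
    (q.2.1 - p.2.1).im, (q.2.2 - p.2.2).re, (q.2.2 - p.2.2).im]
  have hD : Continuous D := by
    refine continuous_pi fun i => ?_
    fin_cases i <;> simp [D] <;> fun_prop
  have hD0 : D p = 0 := by ext i; fin_cases i <;> simp [D]
  have e := (hD.continuousAt (x := p)).eventually (by rw [hD0]; exact hgr)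
  filter_upwards [e] with q hq
  have h1 : C (q, star q) = fun i => (D q i : ℂ) := by
    ext i
    fin_cases i <;>
      simp [C, D, Complex.re_eq_add_conj, Complex.im_eq_sub_conj] <;> ring
  have h2 : p + A' (D q) = q := by
    ext <;> apply Complex.ext <;> simp [A', A, D]
  rw [h1, hq, h2]

/-- A real-analytic hypersurface is locally given by a Hermitian holomorphic equation
`H (q, q̄) = 0`. -/
theorem IsRealAnalyticHypersurface.exists_hermitian_equation {M : Set CThree}
    (hM : IsRealAnalyticHypersurface M) {p : CThree} (hp : p ∈ M) :
    ∃ H : CThree × CThree → ℂ, AnalyticAt ℂ H (p, star p) ∧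
      (∀ y, star (H (star y.2, star y.1)) = H y) ∧
      (∀ᶠ q in 𝓝 p, q ∈ M ↔ H (q, star q) = 0) ∧
      ∃ a, fderiv ℂ H (p, star p) (a, 0) ≠ 0 := by
  obtain ⟨r, hr, hdr, hMr⟩ := hM p hp
  obtain ⟨H₀, hH₀, hHr⟩ := exists_polarization hr
  have : NormedStarGroup (CThree × CThree) := Prod.normedStarGroup
  have hswap : AnalyticAt ℂ (fun y : CThree × CThree => star (H₀ (star y.2, star y.1)))
      (p, star p) := by
    have h1 : AnalyticAt ℂ (fun y : CThree × CThree => star (H₀ (star y))) (star p, p) :=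
      AnalyticAt.star_star (by simpa [Prod.star_def] using hH₀)
    exact AnalyticAt.comp_of_eq (g := fun y : CThree × CThree => star (H₀ (star y)))
      (f := fun y : CThree × CThree => (y.2, y.1)) h1 (by fun_prop) rfl
  -- Averaging with the Hermitian conjugate forces the symmetry everywhere and changes nothing on
  -- the diagonal near `p`, where `H₀` is real.
  set H : CThree × CThree → ℂ := fun y => (1 / 2 : ℂ) * (H₀ y + star (H₀ (star y.2, star y.1)))
    with hHdef
  have hH : AnalyticAt ℂ H (p, star p) := analyticAt_const.mul (hH₀.add hswap)
  have hHr' : ∀ᶠ q in 𝓝 p, H (q, star q) = r q := by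
    filter_upwards [hHr] with q hq
    simp only [hHdef, star_star, hq]
    simp
    ring
  refine ⟨H, hH, ?_, ?_, ?_⟩
  · intro y
    simp [hHdef, add_comm]
  · filter_upwards [hHr', hMr] with q h1 h2
    rw [h2, h1]; simp
  -- The antiholomorphic differential is the conjugate of the holomorphic one; if the latter
  -- vanished, so would `dr`.
  · by_contra! hcon
    apply hdr
    have h1 : ∀ v, (fderiv ℝ r p v : ℂ) = fderiv ℂ H (p, star p) (v, star v) := by
      intro v
      rw [← fderiv_diagonal_apply hH.differentiableAt, Filter.EventuallyEq.fderiv_eq hHr']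
      have := (Complex.ofRealCLM.hasFDerivAt.comp p hr.differentiableAt.hasFDerivAt).fderiv
      exact (congrArg (fun A : CThree →L[ℝ] ℂ => A v) this).symm
    have h2 : ∀ᶠ q in 𝓝 p, (H (q, star q)).im = 0 := by
      filter_upwards [hHr'] with q hq
      rw [hq, Complex.ofReal_im]
    refine ContinuousLinearMap.ext fun v => ?_
    have h3 : ((v, star v) : CThree × CThree) = (v, 0) + (0, star v) := by simp
    have h4 := h1 v
    rw [h3, map_add, hcon, fderiv_of_real_diagonal hH.differentiableAt h2, hcon] at h4
    simpa using h4

/-- The first two coordinates parametrize `ker l`, and the last basis vector is scaled to have `l e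
= 1 / (2i)`, the coefficient of `w` in `Im w = (w - w̄) / 2i`. -/
theorem exists_linear_normalization {l : CThree →L[ℂ] ℂ} (hl : ∃ a, l a ≠ 0) :
    ∃ B : ((ℂ × ℂ) × ℂ) ≃L[ℂ] CThree, ∀ x, l (B x) = x.2 / (2 * Complex.I) := by
  obtain ⟨a, ha⟩ := hl
  set e : CThree := (l a)⁻¹ • (1 / (2 * Complex.I)) • a
  have he : l e = 1 / (2 * Complex.I) := by
    simp [e]
    field_simp
  have hsurj : Function.Surjective l.toLinearMap := by
    intro c
    exact ⟨(c / l a) • a, by simp [ha]⟩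
  have hrank : Module.finrank ℂ (ℂ × ℂ) = Module.finrank ℂ l.toLinearMap.ker := by
    have h := LinearMap.finrank_range_add_finrank_ker l.toLinearMap
    rw [LinearMap.range_eq_top.2 hsurj, finrank_top] at h
    simp at h ⊢
    omega
  let K := LinearEquiv.ofFinrankEq (R := ℂ) (ℂ × ℂ) l.toLinearMap.ker hrank
  let B₀ : ((ℂ × ℂ) × ℂ) →ₗ[ℂ] CThree :=
    (l.toLinearMap.ker.subtype ∘ₗ K.toLinearMap).coprod (LinearMap.toSpanSingleton ℂ CThree e)
  have hB₀ : ∀ x, l (B₀ x) = x.2 / (2 * Complex.I) := by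
    intro x
    have : l (K x.1) = 0 := (K x.1).2
    simp only [B₀, LinearMap.coprod_apply, LinearMap.toSpanSingleton_apply, map_add, map_smul, he]
    simp [this]
    rw [div_eq_mul_inv, mul_inv, Complex.inv_I]
    ring
  have hinj : Function.Injective B₀ := by
    rw [← LinearMap.ker_eq_bot, LinearMap.ker_eq_bot']
    intro x hx
    have h1 := hB₀ x
    rw [hx, map_zero] at h1
    have h2 : x.2 = 0 := by simpa using h1.symm
    have h3 : K x.1 = 0 := by
      simpa [B₀, h2] using hx
    exact Prod.ext (by simpa using h3) h2
  exact ⟨(B₀.linearEquivOfInjective hinj (by simp)).toContinuousLinearEquiv, hB₀⟩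

/-- Normal coordinates of a real-analytic hypersurface at a point. -/
theorem IsRealAnalyticHypersurface.exists_normal_chart {M : Set CThree}
    (hM : IsRealAnalyticHypersurface M) {p : CThree} (hp : p ∈ M) :
    ∃ (Ψ : OpenPartialHomeomorph CThree ((ℂ × ℂ) × ℂ)) (F : (ℂ × ℂ) × (ℂ × ℂ) × ℂ → ℂ),
      p ∈ Ψ.source ∧ Ψ p = 0 ∧ AnalyticAt ℂ Ψ p ∧ AnalyticAt ℂ Ψ.symm 0 ∧ AnalyticAt ℂ F 0 ∧
      (∀ᶠ x in 𝓝 (0 : (ℂ × ℂ) × ℂ), F (x.1, 0, x.2) = 0) ∧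
      (∀ᶠ x in 𝓝 (0 : (ℂ × ℂ) × ℂ), F (0, x.1, x.2) = 0) ∧
      (∀ᶠ y in 𝓝 (0 : (ℂ × ℂ) × (ℂ × ℂ) × ℂ),
        star (F (star y.2.1, star y.1, star y.2.2)) = F y) ∧
      ∀ᶠ x in 𝓝 (0 : (ℂ × ℂ) × ℂ),
        Ψ.symm x ∈ M ↔ F (x.1, star x.1, (x.2.re : ℂ)) = (x.2.im : ℂ) := by
  obtain ⟨H, hH, hherm, hHM, a, ha⟩ := hM.exists_hermitian_equation hp
  have hreal : ∀ᶠ q in 𝓝 p, (H (q, star q)).im = 0 := by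
    refine Eventually.of_forall fun q => ?_
    have := hherm (q, star q)
    rw [star_star] at this
    exact Complex.conj_eq_iff_im.1 this
  obtain ⟨B, hB⟩ := exists_linear_normalization
    (l := (fderiv ℂ H (p, star p)).comp (.inl ℂ CThree CThree)) ⟨a, by simpa using ha⟩
  replace hB : ∀ x, fderiv ℂ H (p, star p) (B x, 0) = x.2 / (2 * Complex.I) := by simpa using hB
  have hH0 : H (p, star p) = 0 := hHM.self_of_nhds.1 hp
  set θ : (ℂ × ℂ) × ℂ → CThree := fun x => p + B x with hθdef
  have hθ : AnalyticAt ℂ θ 0 := analyticAt_const.add (B.toContinuousLinearMap.analyticAt 0)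
  have hθ0 : θ 0 = p := by simp [hθdef]
  have hθd : HasFDerivAt θ (B : _ →L[ℂ] CThree) 0 :=
    B.toContinuousLinearMap.hasFDerivAt.const_add p
  have hsθ : AnalyticAt ℂ (fun x => star (θ (star x))) 0 := AnalyticAt.star_star (by simpa using hθ)
  set φ : ((ℂ × ℂ) × ℂ) × ((ℂ × ℂ) × ℂ) → CThree × CThree :=
    fun y => (θ y.1, star (θ (star y.2))) with hφdef
  have hφ0 : φ 0 = (p, star p) := by simp [hφdef, hθ0]
  have hφa : AnalyticAt ℂ φ 0 := by
    have h1 : AnalyticAt ℂ (fun y : ((ℂ × ℂ) × ℂ) × ((ℂ × ℂ) × ℂ) => θ y.1) 0 :=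
      AnalyticAt.comp_of_eq (g := θ) hθ analyticAt_fst rfl
    have h2 : AnalyticAt ℂ (fun y : ((ℂ × ℂ) × ℂ) × ((ℂ × ℂ) × ℂ) => star (θ (star y.2))) 0 :=
      AnalyticAt.comp_of_eq (g := fun x => star (θ (star x))) hsθ analyticAt_snd rfl
    exact h1.prod h2
  set H₀ : ((ℂ × ℂ) × ℂ) × ((ℂ × ℂ) × ℂ) → ℂ := fun y => H (φ y) with hH₀def
  have hH₀ : AnalyticAt ℂ H₀ 0 := AnalyticAt.comp_of_eq (g := H) hH hφa hφ0
  have hφd : ∀ y, fderiv ℂ φ 0 y = (B y.1, star (B (star y.2))) := by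
    intro y
    have h1 : HasFDerivAt (fun y : ((ℂ × ℂ) × ℂ) × ((ℂ × ℂ) × ℂ) => θ y.1) _ 0 :=
      HasFDerivAt.comp (g := θ) (f := Prod.fst) 0 hθd hasFDerivAt_fst
    have h2 : HasFDerivAt (fun y : ((ℂ × ℂ) × ℂ) × ((ℂ × ℂ) × ℂ) => star (θ (star y.2))) _ 0 :=
      HasFDerivAt.comp (g := fun x => star (θ (star x))) (f := Prod.snd) 0
        hsθ.differentiableAt.hasFDerivAt hasFDerivAt_snd
    have h3 : HasFDerivAt φ _ 0 := h1.prodMk h2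
    rw [h3.fderiv]
    refine Prod.ext rfl ?_
    have := fderiv_star_star_apply (f := θ) (x := 0) (by simpa using hθ.differentiableAt) y.2
    rw [star_zero, hθd.fderiv] at this
    exact this
  have hH₀d : ∀ y, fderiv ℂ H₀ 0 y = (y.1.2 - y.2.2) / (2 * Complex.I) := by
    intro y
    have h1 : HasFDerivAt H (fderiv ℂ H (p, star p)) (φ 0) := by
      rw [hφ0]; exact hH.differentiableAt.hasFDerivAt
    have h2 : HasFDerivAt H₀ _ 0 := h1.comp 0 hφa.differentiableAt.hasFDerivAt
    rw [h2.fderiv, ContinuousLinearMap.comp_apply, hφd]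
    have h3 : ((B y.1, star (B (star y.2))) : CThree × CThree) =
      (B y.1, 0) + (0, star (B (star y.2))) := by simp
    rw [h3, map_add, fderiv_of_real_diagonal hH.differentiableAt hreal, star_star, hB, hB]
    simp
    ring
  have hH₀h : ∀ᶠ y in 𝓝 (0 : ((ℂ × ℂ) × ℂ) × ((ℂ × ℂ) × ℂ)),
      star (H₀ (star y.2, star y.1)) = H₀ y := by
    refine Eventually.of_forall fun y => ?_
    simp only [hH₀def, hφdef]
    rw [← hherm]
    simp
  obtain ⟨W, F, hW, hW0, hWd, hF, hFr, hFl, hFh, hFM⟩ :=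
    exists_normal_form hH₀ (by simp [hH₀def, hφ0, hH0]) hH₀h hH₀d
  -- Since `dW = ds` at the origin, `Φ` has the invertible differential `B` there; the chart is its
  -- local inverse.
  set Φ : (ℂ × ℂ) × ℂ → CThree := fun x => θ (x.1, W x) with hΦdef
  have hΦ0 : Φ 0 = p := by
    simp only [hΦdef, hW0]; exact hθ0
  have hxW : AnalyticAt ℂ (fun x : (ℂ × ℂ) × ℂ => (x.1, W x)) 0 := analyticAt_fst.prod hW
  have hΦ : AnalyticAt ℂ Φ 0 :=
    AnalyticAt.comp_of_eq (g := θ) hθ hxW (by simp [hW0])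
  have hΦd : fderiv ℂ Φ 0 = (B : _ →L[ℂ] CThree) := by
    refine ContinuousLinearMap.ext fun x => ?_
    have h1 : HasFDerivAt (fun x : (ℂ × ℂ) × ℂ => (x.1, W x)) _ 0 :=
      hasFDerivAt_fst.prodMk hW.differentiableAt.hasFDerivAt
    rw [hΦdef, fderiv_comp_zero_apply hθ.differentiableAt h1 (by simp [hW0]), hθd.fderiv]
    simp [hWd]
  have hΦs : HasStrictFDerivAt Φ (B : _ →L[ℂ] CThree) 0 := hΦd ▸ hΦ.hasStrictFDerivAt
  set P := hΦs.toOpenPartialHomeomorph Φ with hP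
  have hPcoe : (P : (ℂ × ℂ) × ℂ → CThree) = Φ := hΦs.toOpenPartialHomeomorph_coe
  have hP0 : (0 : (ℂ × ℂ) × ℂ) ∈ P.source := hΦs.mem_toOpenPartialHomeomorph_source
  have hPp : P 0 = p := by rw [hPcoe, hΦ0]
  refine ⟨P.symm, F, ?_, ?_, ?_, ?_, hF, hFr, hFl, hFh, ?_⟩
  · rw [← hPp]; exact P.map_source hP0
  · rw [← hPp]; exact P.left_inv hP0
  · rw [← hPp]
    exact P.analyticAt_symm' (i := B) hP0 (by rwa [hPcoe]) (by rw [hPcoe, hΦd])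
  · rw [OpenPartialHomeomorph.symm_symm, hPcoe]; exact hΦ
  · have e1 := hΦ.continuousAt.eventually (by rw [hΦ0]; exact hHM)
    have e2 := hFM.comp_continuousAt_zero (φ := fun x : (ℂ × ℂ) × ℂ => (x, star x))
      (by fun_prop) (by simp)
    filter_upwards [e1, e2] with x h1 h2
    rw [OpenPartialHomeomorph.symm_symm, hPcoe, h1]
    have h3 : H (Φ x, star (Φ x)) = H₀ ((x.1, W x), (star x.1, star (W x))) := by
      simp [hH₀def, hφdef, hΦdef, Prod.star_def]
    rw [h3]
    rw [star_star] at h2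
    refine h2.trans ?_
    rw [Complex.re_eq_add_conj, Complex.im_eq_sub_conj]
    rfl

/-! ### Complexified directional derivatives -/

section ComplexifiedDerivative

variable {F : Type*} [NormedAddCommGroup F] [NormedSpace ℝ F] [Module ℂ F]

theorem CVector.deriv_congr {f g : CThree → F} {p : CThree} (h : f =ᶠ[𝓝 p] g) (X : CVector) :
    X.deriv f p = X.deriv g p := by
  simp only [CVector.deriv, dHol, dAntihol, h.fderiv_eq]

/-- By complex linearity of `dT`, the operators `∂/∂zⱼ` and `∂/∂z̄ⱼ` isolate the two groups of
independent variables. A complexified tangent vector is thus an ordinary vector at `(p, p̄)`. -/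
theorem CVector.deriv_diagonal {F : Type*} [NormedAddCommGroup F] [NormedSpace ℂ F]
    {T : CThree × CThree → F} {p : CThree}
    (hT : DifferentiableAt ℂ T (p, star p)) (X : CVector) :
    X.deriv (fun q => T (q, star q)) p = fderiv ℂ T (p, star p) X := by
  obtain ⟨a, b⟩ := X
  simp only [CVector.deriv, dHol, dAntihol, fderiv_diagonal_apply hT]
  set D := fderiv ℂ T (p, star p)
  simp only [← map_smul, ← map_sub, ← map_add]
  congr 1
  have hI : ∀ x : CThree, Complex.I • Complex.I • x = -x := by
    intro x; rw [smul_smul, Complex.I_mul_I, neg_one_smul]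
  have hI' : ∀ x : CThree, Complex.I • star Complex.I • x = x := by
    intro x; rw [smul_smul]; simp
  have h2 : ∀ x : CThree, (1 / 2 : ℂ) • (x + x) = x := by
    intro x; rw [← two_smul ℂ x, smul_smul]; norm_num
  refine Prod.ext ?_ ?_
  · simp only [Prod.fst_add, Prod.smul_fst, Prod.fst_sub, hI, sub_neg_eq_add, h2, add_neg_cancel,
      smul_zero, add_zero]
  · simp only [Prod.snd_add, Prod.smul_snd, Prod.snd_sub, star_smul, star_star, hI', h2, sub_self,
      smul_zero, zero_add]

theorem CVector.deriv_fst {Y : CThree → CVector} {p : CThree} (hY : DifferentiableAt ℝ Y p)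
    (X : CVector) : (X.deriv Y p).1 = X.deriv (fun q => (Y q).1) p := by
  simp only [CVector.deriv, dHol, dAntihol, fderiv.fst hY]
  rfl

theorem CVector.deriv_snd {Y : CThree → CVector} {p : CThree} (hY : DifferentiableAt ℝ Y p)
    (X : CVector) : (X.deriv Y p).2 = X.deriv (fun q => (Y q).2) p := by
  simp only [CVector.deriv, dHol, dAntihol, fderiv.snd hY]
  rfl

/-- The product rule for the pairing of a holomorphic one-form, restricted to the diagonal, with a
complexified vector field. -/
theorem CVector.deriv_pairing {T : CThree × CThree → CVector →L[ℂ] ℂ} {V : CThree → CVector}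
    {p : CThree} (hT : DifferentiableAt ℂ T (p, star p)) (hV : DifferentiableAt ℝ V p)
    (X : CVector) :
    X.deriv (fun q => T (q, star q) (V q)) p =
      fderiv ℂ T (p, star p) X (V p) + T (p, star p) (X.deriv V p) := by
  have h1 : HasFDerivAt (fun q => T (q, star q) (V q)) _ p :=
    HasFDerivAt.comp (g := fun x : (CVector →L[ℂ] ℂ) × CVector => x.1 x.2) p
      ((isBoundedBilinearMap_apply.hasFDerivAt (𝕜 := ℂ) (T (p, star p), V p)).restrictScalars ℝ)
      ((hasFDerivAt_diagonal hT).prodMk hV.hasFDerivAt)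
  have h2 : ∀ v, fderiv ℝ (fun q => T (q, star q) (V q)) p v =
      fderiv ℂ T (p, star p) (v, star v) (V p) + T (p, star p) (fderiv ℝ V p v) := by
    intro v
    rw [h1.fderiv]
    simp [add_comm]
  have h3 := CVector.deriv_diagonal hT X
  rw [← h3]
  simp only [CVector.deriv, dHol, dAntihol, h2, fderiv_diagonal_apply hT, map_add, map_sub,
    map_smul, add_apply, sub_apply,
    smul_apply, smul_eq_mul]
  ring

theorem contDiffAt_pairing {T : CThree × CThree → CVector →L[ℂ] ℂ} {V : CThree → CVector}
    {p : CThree} {n : WithTop ℕ∞} (hT : AnalyticAt ℂ T (p, star p)) (hV : ContDiffAt ℝ n V p) :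
    ContDiffAt ℝ n (fun q => T (q, star q) (V q)) p := by
  have h1 : ContDiffAt ℝ n (fun q : CThree => T (q, star q)) p :=
    ContDiffAt.comp (g := T) p hT.restrictScalars.contDiffAt
      (contDiffAt_id.prodMk (starL' ℝ : CThree ≃L[ℝ] CThree).contDiff.contDiffAt)
  have h2 : ContDiff ℝ n (fun x : (CVector →L[ℂ] ℂ) × CVector => x.1 x.2) :=
    (isBoundedBilinearMap_apply (𝕜 := ℂ)).contDiff.restrict_scalars ℝ
  exact h2.contDiffAt.comp p (h1.prodMk hV)

end ComplexifiedDerivative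

/-! ### Local equations and complexified tangent spaces -/

/-- `G (q, q̄) = 0` is a real equation of `M` near `p ∈ M`, with nonzero holomorphic differential. -/
structure IsLocalEquation (G : CThree × CThree → ℂ) (M : Set CThree) (p : CThree) : Prop where
  mem : p ∈ M
  analyticAt : AnalyticAt ℂ G (p, star p)
  real : ∀ᶠ q in 𝓝 p, (G (q, star q)).im = 0
  mem_iff : ∀ᶠ q in 𝓝 p, q ∈ M ↔ G (q, star q) = 0
  exists_ne : ∃ a, fderiv ℂ G (p, star p) (a, 0) ≠ 0

namespace IsLocalEquation

variable {G : CThree × CThree → ℂ} {M : Set CThree} {p : CThree}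

theorem eventually_analyticAt (h : IsLocalEquation G M p) :
    ∀ᶠ q in 𝓝 p, AnalyticAt ℂ G (q, star q) :=
  (show Continuous fun q : CThree => (q, star q) by fun_prop).continuousAt.eventually
    h.analyticAt.eventually_analyticAt

theorem conj_eq (h : IsLocalEquation G M p) (b : CThree) :
    fderiv ℂ G (p, star p) (0, b) = star (fderiv ℂ G (p, star p) (star b, 0)) :=
  fderiv_of_real_diagonal h.analyticAt.differentiableAt h.real b

/-- The real form of the equation. -/
theorem hasStrictFDerivAt_re (h : IsLocalEquation G M p) :
    HasStrictFDerivAt (fun q => (G (q, star q)).re)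
      (fderiv ℝ (fun q => (G (q, star q)).re) p) p := by
  have h1 : AnalyticAt ℝ (fun q : CThree => (G (q, star q))) p :=
    AnalyticAt.comp (g := G) (f := fun q : CThree => (q, star q)) h.analyticAt.restrictScalars
      (((ContinuousLinearMap.id ℝ CThree).prod
          ((starL' ℝ : CThree ≃L[ℝ] CThree) : CThree →L[ℝ] CThree)).analyticAt p)
  exact ((Complex.reCLM.analyticAt _).comp h1).hasStrictFDerivAt

theorem fderiv_re (h : IsLocalEquation G M p) (v : CThree) :
    (fderiv ℝ (fun q => (G (q, star q)).re) p v : ℂ) = fderiv ℂ G (p, star p) (v, star v) := by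
  have h1 : HasFDerivAt (fun q => ((G (q, star q)).re : ℂ)) _ p :=
    Complex.ofRealCLM.hasFDerivAt.comp p h.hasStrictFDerivAt_re.hasFDerivAt
  have h2 : (fun q => ((G (q, star q)).re : ℂ)) =ᶠ[𝓝 p] fun q => G (q, star q) := by
    filter_upwards [h.real] with q hq
    exact Complex.ext (by simp) (by simp [hq])
  rw [← fderiv_diagonal_apply h.analyticAt.differentiableAt, ← h2.fderiv_eq, h1.fderiv]
  rfl

/-- If the real differential vanished on both `a` and `i • a`, the real and imaginary parts of the
holomorphic derivative along `a` would vanish. -/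
theorem exists_fderiv_re_eq_one (h : IsLocalEquation G M p) :
    ∃ v, fderiv ℝ (fun q => (G (q, star q)).re) p v = 1 := by
  by_contra! hcon
  obtain ⟨a, ha⟩ := h.exists_ne
  apply ha
  have h0 : ∀ v, fderiv ℝ (fun q => (G (q, star q)).re) p v = 0 := by
    intro v
    by_contra hv
    refine hcon ((fderiv ℝ (fun q => (G (q, star q)).re) p v)⁻¹ • v) ?_
    rw [map_smul, smul_eq_mul, inv_mul_cancel₀ hv]
  have h1 := h.fderiv_re a
  have h2 := h.fderiv_re (Complex.I • a)
  have hs : ∀ v : CThree, ((v, star v) : CThree × CThree) = (v, 0) + (0, star v) := by simp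
  have e1 : fderiv ℂ G (p, star p) (Complex.I • a, 0) =
      Complex.I * fderiv ℂ G (p, star p) (a, 0) := by
    rw [← smul_eq_mul, ← map_smul]; simp
  rw [h0, hs a, map_add, h.conj_eq, star_star] at h1
  rw [h0, hs (Complex.I • a), map_add, h.conj_eq, star_star] at h2
  rw [e1] at h2
  have h1' := congrArg Complex.re h1
  have h2' := congrArg Complex.re h2
  simp at h1' h2'
  apply Complex.ext <;> simp <;> linarith

theorem cTangent_le (h : IsLocalEquation G M p) {X : CVector} (hX : X ∈ cTangent M p) :
    fderiv ℂ G (p, star p) X = 0 := by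
  have h1 : AnalyticAt ℝ (fun q => (G (q, star q)).re) p := by
    have h1 : AnalyticAt ℝ (fun q : CThree => (G (q, star q))) p :=
      AnalyticAt.comp (g := G) (f := fun q : CThree => (q, star q)) h.analyticAt.restrictScalars
        (((ContinuousLinearMap.id ℝ CThree).prod
            ((starL' ℝ : CThree ≃L[ℝ] CThree) : CThree →L[ℝ] CThree)).analyticAt p)
    exact (Complex.reCLM.analyticAt _).comp h1
  have h2 : ∀ᶠ q in 𝓝[M] p, (G (q, star q)).re = 0 := by
    filter_upwards [nhdsWithin_le_nhds h.mem_iff, self_mem_nhdsWithin] with q hq hqM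
    rw [hq.1 hqM, Complex.zero_re]
  have h3 := hX _ h1 h2
  have h4 : (fun q => ((G (q, star q)).re : ℂ)) =ᶠ[𝓝 p] fun q => G (q, star q) := by
    filter_upwards [h.real] with q hq
    exact Complex.ext (by simp) (by simp [hq])
  rwa [CVector.deriv_congr h4, CVector.deriv_diagonal h.analyticAt.differentiableAt] at h3

/-- Every condition is open along `M`. This lets sections, whose tangency holds at all nearby points
of `M`, be tested against the single equation `G`. -/
theorem eventually_isLocalEquation (h : IsLocalEquation G M p) :
    ∀ᶠ q in 𝓝[M] p, IsLocalEquation G M q := by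
  obtain ⟨a, ha⟩ := h.exists_ne
  have hc : ContinuousAt (fun q : CThree => fderiv ℂ G (q, star q) (a, 0)) p := by
    have h1 : ContinuousAt (fun q : CThree => fderiv ℂ G (q, star q)) p :=
      ContinuousAt.comp (g := fderiv ℂ G) h.analyticAt.fderiv.continuousAt
        (show Continuous fun q : CThree => (q, star q) by fun_prop).continuousAt
    exact h1.clm_apply continuousAt_const
  filter_upwards [self_mem_nhdsWithin, nhdsWithin_le_nhds h.eventually_analyticAt,
    nhdsWithin_le_nhds h.real.eventually_nhds, nhdsWithin_le_nhds h.mem_iff.eventually_nhds,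
    nhdsWithin_le_nhds (hc.eventually_ne ha)] with q h1 h2 h3 h4 h5
  exact ⟨h1, h2, h3, h4, a, h5⟩

/-- A real function vanishing on the hypersurface has differential proportional to that of the
equation. -/
theorem exists_multiplier (h : IsLocalEquation G M p) {φ : CThree → ℝ} {φ' : CThree →L[ℝ] ℝ}
    (hφ : HasStrictFDerivAt φ φ' p) (hφ0 : ∀ᶠ q in 𝓝[M] p, φ q = 0) :
    ∃ c : ℝ, ∀ v, φ' v = c * fderiv ℝ (fun q => (G (q, star q)).re) p v := by
  have hG0 : G (p, star p) = 0 := h.mem_iff.self_of_nhds.1 h.mem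
  have hφp : φ p = 0 := hφ0.self_of_nhdsWithin h.mem
  -- A function vanishing on `M` is constant on the level set of `Re G` near `p`, hence has a
  -- constrained extremum there, and Lagrange multipliers apply.
  have hext : IsLocalExtrOn φ {x | (G (x, star x)).re = (G (p, star p)).re} p := by
    left
    have h1 : ∀ᶠ q in 𝓝 p, q ∈ M → φ q = 0 := eventually_nhdsWithin_iff.1 hφ0
    filter_upwards [nhdsWithin_le_nhds h1, nhdsWithin_le_nhds h.mem_iff, nhdsWithin_le_nhds h.real,
      self_mem_nhdsWithin] with q h2 h3 h4 h5
    rw [hφp, h2 (h3.2 (Complex.ext ?_ ?_))]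
    · rw [← hG0]; exact h5
    · exact h4
  obtain ⟨a, b, hab, he⟩ := hext.exists_multipliers_of_hasStrictFDerivAt_1d
    h.hasStrictFDerivAt_re hφ
  have he' : ∀ v, a * fderiv ℝ (fun q => (G (q, star q)).re) p v + b * φ' v = 0 := fun v =>
    congrArg (fun A : CThree →L[ℝ] ℝ => A v) he
  have hb : b ≠ 0 := by
    rintro rfl
    obtain ⟨v, hv⟩ := h.exists_fderiv_re_eq_one
    have := he' v
    rw [hv] at this
    apply hab
    simpa using this
  refine ⟨-a / b, fun v => ?_⟩
  have := he' v
  field_simp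
  linarith

/-- Complexified tangent vectors annihilate every smooth map vanishing on the hypersurface. -/
theorem deriv_eq_zero (h : IsLocalEquation G M p) {F : Type*} [NormedAddCommGroup F]
    [NormedSpace ℝ F] [Module ℂ F] [IsScalarTower ℝ ℂ F] {f : CThree → F}
    (hf : ContDiffAt ℝ 1 f p) (hf0 : ∀ᶠ q in 𝓝[M] p, f q = 0) {X : CVector}
    (hX : fderiv ℂ G (p, star p) X = 0) : X.deriv f p = 0 := by
  set g' := fderiv ℝ (fun q => (G (q, star q)).re) p with hg'
  obtain ⟨v₀, hv₀⟩ := h.exists_fderiv_re_eq_one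
  -- Vector values are reduced to scalar ones by composing with real functionals.
  have hker : ∀ v, g' v = 0 → fderiv ℝ f p v = 0 := by
    intro v hv
    refine SeparatingDual.eq_zero_of_forall_dual_eq_zero (R := ℝ) fun l => ?_
    obtain ⟨c, hc⟩ := h.exists_multiplier (φ := fun q => l (f q))
      (l.hasStrictFDerivAt.comp p (hf.hasStrictFDerivAt one_ne_zero)) (by
        filter_upwards [hf0] with q hq
        rw [hq, map_zero])
    have := hc v
    rw [← hg', hv, mul_zero] at this
    exact this
  obtain ⟨w, hf'⟩ : ∃ w, ∀ v, fderiv ℝ f p v = (g' v : ℂ) • w := by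
    refine ⟨fderiv ℝ f p v₀, fun v => ?_⟩
    have h1 := hker (v - g' v • v₀) (by rw [map_sub, map_smul, hv₀]; simp)
    rw [map_sub, map_smul, sub_eq_zero] at h1
    rw [h1]
    exact (algebraMap_smul ℂ (g' v) _).symm
  have h4 : (fun q => ((G (q, star q)).re : ℂ)) =ᶠ[𝓝 p] fun q => G (q, star q) := by
    filter_upwards [h.real] with q hq
    exact Complex.ext (by simp) (by simp [hq])
  have h5 : X.deriv f p = fderiv ℂ G (p, star p) X • w := by
    rw [← CVector.deriv_diagonal h.analyticAt.differentiableAt]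
    simp only [CVector.deriv, dHol, dAntihol, fderiv_diagonal_apply h.analyticAt.differentiableAt,
      ← h.fderiv_re]
    simp only [hf', ← hg', smul_eq_mul]
    module
  rw [h5, hX, zero_smul]

/-- One inclusion tests the definition on `Re G`; the other is the multiplier argument, by which the
differential of any function vanishing on `M` is a multiple of that of `Re G`. -/
theorem mem_cTangent_iff (h : IsLocalEquation G M p) {X : CVector} :
    X ∈ cTangent M p ↔ fderiv ℂ G (p, star p) X = 0 := by
  refine ⟨h.cTangent_le, fun hX f hf hf0 => ?_⟩
  refine h.deriv_eq_zero (Complex.ofRealCLM.contDiff.contDiffAt.comp p hf.contDiffAt) ?_ hX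
  filter_upwards [hf0] with q hq
  simp [hq]

end IsLocalEquation

/-! ### The Levi form and the mixed Hessian -/

namespace IsLocalEquation

variable {G : CThree × CThree → ℂ} {M : Set CThree} {p : CThree}

theorem mem_tangent10_iff (h : IsLocalEquation G M p) {X : CVector} :
    X ∈ tangent10 M p ↔ fderiv ℂ G (p, star p) X = 0 ∧ X.2 = 0 := by
  simp [tangent10, h.mem_cTangent_iff]

theorem mem_tangent01_iff (h : IsLocalEquation G M p) {X : CVector} :
    X ∈ tangent01 M p ↔ fderiv ℂ G (p, star p) X = 0 ∧ X.1 = 0 := by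
  simp [tangent01, h.mem_cTangent_iff]

theorem fderiv_conj_eq_zero (h : IsLocalEquation G M p) {X : CVector}
    (hX : X ∈ tangent10 M p) : fderiv ℂ G (p, star p) (star X.2, star X.1) = 0 := by
  obtain ⟨h1, h2⟩ := h.mem_tangent10_iff.1 hX
  have h3 : X = (X.1, 0) := Prod.ext rfl h2
  rw [h2, star_zero, h.conj_eq, star_star, ← h3, h1, star_zero]

/-- The differential of the equation along a derivative of a section of the complexified tangent
bundle is minus the Hessian. -/
theorem fderiv_deriv_eq_neg_hessian (h : IsLocalEquation G M p) {V : CThree → CVector}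
    (hV : ContDiffAt ℝ 1 V p)
    (hV0 : ∀ᶠ q in 𝓝[M] p, fderiv ℂ G (q, star q) (V q) = 0) {X : CVector}
    (hX : fderiv ℂ G (p, star p) X = 0) :
    fderiv ℂ G (p, star p) (X.deriv V p) = -fderiv ℂ (fderiv ℂ G) (p, star p) X (V p) := by
  have h1 := h.deriv_eq_zero (contDiffAt_pairing h.analyticAt.fderiv hV) hV0 hX
  rw [CVector.deriv_pairing h.analyticAt.fderiv.differentiableAt
    (hV.differentiableAt one_ne_zero)] at h1
  linear_combination h1

/-- The components of the Lie bracket of a section of `T^{1,0} M` with the conjugate of another one,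
in terms of the Hessian of a local equation. -/
theorem fderiv_cBracket (h : IsLocalEquation G M p) {L K : CThree → CVector}
    (hL : IsSection10 M p L) (hK : IsSection10 M p K) :
    fderiv ℂ G (p, star p) ((cBracket L (cConj K) p).1, 0) =
        fderiv ℂ (fderiv ℂ G) (p, star p) (0, star (K p).1) (L p) ∧
      fderiv ℂ G (p, star p) (cBracket L (cConj K) p) = 0 := by
  have hLs : ContDiffAt ℝ 1 L p := hL.1.of_le (by exact_mod_cast le_top)
  have hKs : ContDiffAt ℝ 1 K p := hK.1.of_le (by exact_mod_cast le_top)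
  have hcs : ContDiffAt ℝ 1 (cConj K) p := by
    have hs : ContDiff ℝ 1 (fun x : CThree => star x) :=
      (starL' ℝ : CThree ≃L[ℝ] CThree).contDiff
    exact (hs.contDiffAt.comp p hKs.snd).prodMk (hs.contDiffAt.comp p hKs.fst)
  have hLp := h.mem_tangent10_iff.1 (hL.2.self_of_nhdsWithin h.mem)
  have hKp := h.mem_tangent10_iff.1 (hK.2.self_of_nhdsWithin h.mem)
  have hK0 : fderiv ℂ G (p, star p) (cConj K p) = 0 :=
    h.fderiv_conj_eq_zero (hK.2.self_of_nhdsWithin h.mem)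
  have hKc : cConj K p = (0, star (K p).1) := by simp [cConj, hKp.2]
  have eL : ∀ᶠ q in 𝓝[M] p, fderiv ℂ G (q, star q) (L q) = 0 := by
    filter_upwards [hL.2, h.eventually_isLocalEquation] with q h1 h2
    exact (h2.mem_tangent10_iff.1 h1).1
  have eK : ∀ᶠ q in 𝓝[M] p, fderiv ℂ G (q, star q) (cConj K q) = 0 := by
    filter_upwards [hK.2, h.eventually_isLocalEquation] with q h1 h2
    exact h2.fderiv_conj_eq_zero h1
  have d1 := h.fderiv_deriv_eq_neg_hessian hLs eL hK0
  have d2 := h.fderiv_deriv_eq_neg_hessian hcs eK hLp.1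
  -- The `(0,1)` component of `L` vanishes on `M` and `K̄` is tangent to `M`; the same reasoning
  -- with the roles exchanged gives `z2`.
  have z1 : ((cConj K p).deriv L p).2 = 0 := by
    rw [CVector.deriv_snd (hLs.differentiableAt one_ne_zero)]
    refine h.deriv_eq_zero hLs.snd ?_ hK0
    filter_upwards [hL.2] with q h1
    exact h1.2
  have z2 : ((L p).deriv (cConj K) p).1 = 0 := by
    rw [CVector.deriv_fst (hcs.differentiableAt one_ne_zero)]
    refine h.deriv_eq_zero hcs.fst ?_ hLp.1
    filter_upwards [hK.2] with q h1
    have : (K q).2 = 0 := h1.2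
    simp [cConj, this]
  have hsymm : fderiv ℂ (fderiv ℂ G) (p, star p) (cConj K p) (L p) =
      fderiv ℂ (fderiv ℂ G) (p, star p) (L p) (cConj K p) :=
    (h.analyticAt.contDiffAt (n := ω)).isSymmSndFDerivAt (by simp) _ _
  constructor
  -- Only `-K̄(L)` contributes to the `(1,0)` part of the bracket. In the second conclusion the two
  -- Hessian terms cancel by symmetry.
  · have e : (((cBracket L (cConj K) p).1, 0) : CVector) = -(cConj K p).deriv L p := by
      refine Prod.ext ?_ ?_
      · simp [cBracket, z2]
      · simp [z1]
    rw [e, map_neg, d1, neg_neg, hKc]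
  · rw [cBracket, map_sub, d1, d2, hsymm, sub_self]

end IsLocalEquation

/-- Levi nondegeneracy in terms of the mixed Hessian of a local equation. -/
theorem HasLeviRank.exists_hessian_ne_zero {G : CThree × CThree → ℂ} {M : Set CThree} {p : CThree}
    (hM : HasLeviRank M p 2) (h : IsLocalEquation G M p) {a : CThree}
    (ha : fderiv ℂ G (p, star p) (a, 0) = 0) (ha0 : a ≠ 0) :
    ∃ b, fderiv ℂ G (p, star p) (0, b) = 0 ∧
      fderiv ℂ (fderiv ℂ G) (p, star p) (0, b) (a, 0) ≠ 0 := by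
  obtain ⟨L, ρ, ⟨hsec, -, hspan⟩, hρ, hrank⟩ := hM
  by_contra! hcon
  have hmem : ((a, 0) : CVector) ∈ Submodule.span ℂ (Set.range fun j => L j p) := by
    rw [hspan]; exact h.mem_tangent10_iff.2 ⟨ha, rfl⟩
  obtain ⟨c, hc⟩ := (Submodule.mem_span_range_iff_exists_fun ℂ).1 hmem
  have hc0 : c ≠ 0 := by
    rintro rfl
    apply ha0
    simpa using (congrArg Prod.fst hc).symm
  have hmul : (leviMatrix ρ L p).mulVec c = 0 := by
    ext j
    -- If `a` is annihilated by the mixed Hessian against tangent directions, the `(1,0)` part of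
    -- `Z` is itself tangent, hence so is its `(0,1)` part. Then `ρ Z = 0`, and `c` lies in the
    -- kernel of the Levi matrix.
    set Z : CVector := ∑ k, c k • Complex.I • cBracket (L k) (cConj (L j)) p with hZ
    have h1 : (leviMatrix ρ L p).mulVec c j = ρ Z := by
      simp [Matrix.mulVec, dotProduct, leviMatrix, hZ, mul_comm]
    rw [h1, Pi.zero_apply]
    have hbr := fun k => h.fderiv_cBracket (hsec k) (hsec j)
    have hZ0 : fderiv ℂ G (p, star p) Z = 0 := by
      rw [hZ, map_sum]
      refine Finset.sum_eq_zero fun k _ => ?_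
      rw [map_smul, map_smul, (hbr k).2, smul_zero, smul_zero]
    have hZ1 : fderiv ℂ G (p, star p) (Z.1, 0) = 0 := by
      have e : ((Z.1, 0) : CVector) =
          ∑ k, c k • Complex.I • ((cBracket (L k) (cConj (L j)) p).1, (0 : CThree)) := by
        rw [hZ]
        simp only [Fin.sum_univ_two]
        refine Prod.ext ?_ ?_ <;> simp
      rw [e, map_sum]
      have hb0 : fderiv ℂ G (p, star p) (0, star (L j p).1) = 0 := by
        have h2 := (hsec j).2.self_of_nhdsWithin h.mem
        have h3 := h.fderiv_conj_eq_zero h2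
        rwa [(h.mem_tangent10_iff.1 h2).2, star_zero] at h3
      have h4 := hcon _ hb0
      rw [← hc, map_sum] at h4
      calc _ = Complex.I * ∑ k, c k * fderiv ℂ (fderiv ℂ G) (p, star p) (0, star (L j p).1)
            (L k p) := by
            rw [Finset.mul_sum]
            refine Finset.sum_congr rfl fun k _ => ?_
            rw [map_smul, map_smul, (hbr k).1, smul_eq_mul, smul_eq_mul]
            ring
        _ = 0 := by
            simp only [map_smul, smul_eq_mul] at h4
            rw [h4, mul_zero]
    refine (hρ Z (h.mem_cTangent_iff.2 hZ0)).2 ?_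
    have e : Z = (Z.1, 0) + (0, Z.2) := by simp
    rw [e]
    refine Submodule.add_mem_sup (h.mem_tangent10_iff.2 ⟨hZ1, rfl⟩)
      (h.mem_tangent01_iff.2 ⟨?_, rfl⟩)
    rw [e, map_add, hZ1, zero_add] at hZ0
    exact hZ0
  have hker := LinearMap.finrank_range_add_finrank_ker (leviMatrix ρ L p).mulVecLin
  rw [← Matrix.rank, hrank] at hker
  simp at hker
  have : c ∈ (⊥ : Submodule ℂ (Fin 2 → ℂ)) := by
    rw [← hker]; exact hmul
  exact hc0 (by simpa using this)

/-! ### Second derivatives and two-jets -/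

section Hessian

variable {A B : Type*} [NormedAddCommGroup A] [NormedSpace ℂ A] [NormedAddCommGroup B]
  [NormedSpace ℂ B]

theorem fderiv_fderiv_apply {f : A → ℂ} {x : A} (hf : AnalyticAt ℂ f x) (v w : A) :
    fderiv ℂ (fun s => fderiv ℂ f s w) x v = fderiv ℂ (fderiv ℂ f) x v w := by
  rw [fderiv_clm_apply hf.fderiv.differentiableAt (differentiableAt_const w)]
  simp

theorem fderiv_fderiv_symm {f : A → ℂ} {x : A} (hf : AnalyticAt ℂ f x) (v w : A) :
    fderiv ℂ (fderiv ℂ f) x v w = fderiv ℂ (fderiv ℂ f) x w v :=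
  (hf.contDiffAt (n := ω)).isSymmSndFDerivAt (by simp) v w

theorem eventually_fderiv_comp_apply {f : B → ℂ} (hf : AnalyticAt ℂ f 0) (T : A →L[ℂ] B) :
    ∀ᶠ s in 𝓝 (0 : A), ∀ v, fderiv ℂ (fun x => f (T x)) s v = fderiv ℂ f (T s) (T v) := by
  filter_upwards [hf.eventually_analyticAt.comp_continuousAt_zero T.continuous.continuousAt
    (map_zero T)] with s hs v
  have h : HasFDerivAt (fun x => f (T x)) _ s :=
    hs.differentiableAt.hasFDerivAt.comp s T.hasFDerivAt
  rw [h.fderiv]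
  rfl

theorem fderiv_fderiv_comp_apply {f : B → ℂ} (hf : AnalyticAt ℂ f 0) (T : A →L[ℂ] B) (v w : A) :
    fderiv ℂ (fderiv ℂ fun x => f (T x)) 0 v w = fderiv ℂ (fderiv ℂ f) 0 (T v) (T w) := by
  have hfT : AnalyticAt ℂ (fun x => f (T x)) 0 :=
    AnalyticAt.comp_of_eq (g := f) hf (T.analyticAt 0) (map_zero T)
  have h1 : (fun s => fderiv ℂ (fun x => f (T x)) s w) =ᶠ[𝓝 0]
      fun s => (fun y => fderiv ℂ f y (T w)) (T s) := by
    filter_upwards [eventually_fderiv_comp_apply hf T] with s hs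
    exact hs w
  rw [← fderiv_fderiv_apply hfT, h1.fderiv_eq,
    fderiv_comp_zero_apply (H := fun y => fderiv ℂ f y (T w))
      (hf.fderiv.differentiableAt.clm_apply (differentiableAt_const _)) T.hasFDerivAt (map_zero T),
    fderiv_fderiv_apply hf]

theorem fderiv_fderiv_star_star [StarAddMonoid A] [NormedStarGroup A] [StarModule ℂ A] {f : A → ℂ}
    (hf : AnalyticAt ℂ f 0) (v w : A) :
    fderiv ℂ (fderiv ℂ fun y => star (f (star y))) 0 v w =
      star (fderiv ℂ (fderiv ℂ f) 0 (star v) (star w)) := by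
  have hf0 : AnalyticAt ℂ f (star 0) := by rwa [star_zero]
  have h1 : (fun s => fderiv ℂ (fun y => star (f (star y))) s w) =ᶠ[𝓝 0]
      fun s => star ((fun y => fderiv ℂ f y (star w)) (star s)) := by
    filter_upwards [hf.eventually_analyticAt.comp_continuousAt_zero
      (continuous_star (R := A)).continuousAt (star_zero A)] with s hs
    exact fderiv_star_star_apply hs.differentiableAt w
  rw [← fderiv_fderiv_apply hf0.star_star, h1.fderiv_eq,
    fderiv_star_star_apply (f := fun y => fderiv ℂ f y (star w))
      (hf0.fderiv.differentiableAt.clm_apply (differentiableAt_const _)), star_zero,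
    fderiv_fderiv_apply hf]

/-- The two-jet of a function vanishes on a subspace on which the function vanishes. -/
theorem jet_eq_zero_of_comp_eq_zero {f : B → ℂ} (hf : AnalyticAt ℂ f 0) (T : A →L[ℂ] B)
    (h : ∀ᶠ s in 𝓝 (0 : A), f (T s) = 0) :
    f 0 = 0 ∧ (∀ v, fderiv ℂ f 0 (T v) = 0) ∧
      ∀ v w, fderiv ℂ (fderiv ℂ f) 0 (T v) (T w) = 0 := by
  have h0 : (fun s => f (T s)) =ᶠ[𝓝 0] fun _ => 0 := h
  refine ⟨by simpa using h.self_of_nhds, fun v => ?_, fun v w => ?_⟩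
  · have := (eventually_fderiv_comp_apply hf T).self_of_nhds v
    rw [map_zero] at this
    rw [← this, h0.fderiv_eq]
    simp
  · rw [← fderiv_fderiv_comp_apply hf T, h0.fderiv.fderiv_eq]
    simp

/-- Mean value inequality on the closed ball of radius `‖x‖`, where the derivative is bounded by `C
* ‖x‖ ^ n`. -/
theorem isBigO_pow_succ_of_fderiv {F : Type*} [NormedAddCommGroup F] [NormedSpace ℂ F] {f : A → F}
    {n : ℕ} (hd : ∀ᶠ x in 𝓝 (0 : A), DifferentiableAt ℂ f x) (h0 : f 0 = 0)
    (h : fderiv ℂ f =O[𝓝 0] fun x => ‖x‖ ^ n) : f =O[𝓝 0] fun x => ‖x‖ ^ (n + 1) := by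
  obtain ⟨C, hC⟩ := h.bound
  obtain ⟨r, hr, hball⟩ := Metric.eventually_nhds_iff_ball.1 (hd.and hC)
  refine IsBigO.of_bound C ?_
  filter_upwards [Metric.ball_mem_nhds (0 : A) hr] with x hx
  have hxr : ‖x‖ < r := by simpa using hx
  have hsub : ∀ y ∈ Metric.closedBall (0 : A) ‖x‖, y ∈ Metric.ball (0 : A) r := by
    intro y hy
    simp at hy ⊢
    linarith
  have hC0 : 0 ≤ C * ‖x‖ ^ n := (norm_nonneg _).trans (by simpa using (hball x hx).2)
  let : NormedSpace ℝ A := NormedSpace.restrictScalars ℝ ℂ A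
  have := Convex.norm_image_sub_le_of_norm_fderiv_le (𝕜 := ℂ) (f := f) (C := C * ‖x‖ ^ n)
    (s := Metric.closedBall (0 : A) ‖x‖) (x := 0) (y := x) (fun y hy => (hball y (hsub y hy)).1)
    (fun y hy => by
      refine (hball y (hsub y hy)).2.trans ?_
      simp only [norm_pow, norm_norm]
      have hy' : ‖y‖ ≤ ‖x‖ := by simpa using hy
      rcases n.eq_zero_or_pos with rfl | hn
      · simp
      -- The constant `C` carries no sign hypothesis; the bound at `x` itself excludes `C < 0`
      -- unless `x = 0`.
      · have hCn : 0 ≤ C ∨ ‖x‖ = 0 := by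
          by_contra! hneg
          have : 0 < ‖x‖ := lt_of_le_of_ne (norm_nonneg _) (Ne.symm hneg.2)
          have := mul_neg_of_neg_of_pos hneg.1 (pow_pos this n)
          linarith
        rcases hCn with hCn | hx0
        · gcongr
        · have : ‖y‖ = 0 := le_antisymm (by linarith) (norm_nonneg _)
          rw [this, hx0])
    (convex_closedBall _ _) (by simp) (by simp)
  rw [h0, sub_zero, sub_zero] at this
  simpa [pow_succ, mul_assoc] using this

/-- An analytic function with vanishing two-jet is of third order. -/
theorem AnalyticAt.isBigO_norm_pow_three {f : A → ℂ} (hf : AnalyticAt ℂ f 0) (h0 : f 0 = 0)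
    (h1 : fderiv ℂ f 0 = 0) (h2 : fderiv ℂ (fderiv ℂ f) 0 = 0) :
    f =O[𝓝 0] fun x => ‖x‖ ^ 3 := by
  have e2 : fderiv ℂ (fderiv ℂ f) =O[𝓝 0] fun x => ‖x‖ ^ 1 := by
    have := hf.fderiv.fderiv.differentiableAt.hasFDerivAt.isBigO_sub
    simpa [h2] using this.norm_right
  have e1 := isBigO_pow_succ_of_fderiv
    (hf.fderiv.eventually_analyticAt.mono fun x hx => hx.differentiableAt) h1 e2
  exact isBigO_pow_succ_of_fderiv (hf.eventually_analyticAt.mono fun x hx => hx.differentiableAt) h0 e1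

end Hessian

/-! ### Hermitian forms on `ℂ²` -/

section Diagonalization

/-- A nondegenerate Hermitian form on `ℂ²` is diagonal with diagonal entries `±1` in some basis. -/
theorem exists_orthonormal_basis_of_hermitian (h : ℂ × ℂ → (ℂ × ℂ →ₗ[ℂ] ℂ))
    (hh : ∀ x y, star (h x y) = h y x) (hnd : ∀ x, x ≠ 0 → ∃ y, h y x ≠ 0) :
    ∃ (e₁ e₂ : ℂ × ℂ) (ε₀ ε : ℝ), (ε₀ = 1 ∨ ε₀ = -1) ∧ (ε = 1 ∨ ε = -1) ∧
      h e₁ e₁ = ε₀ ∧ h e₂ e₂ = ε₀ * ε ∧ h e₁ e₂ = 0 ∧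
      ∀ a b : ℂ, a • e₁ + b • e₂ = 0 → a = 0 ∧ b = 0 := by
  have hreal : ∀ x, (h x x).im = 0 := fun x => Complex.conj_eq_iff_im.1 (hh x x)
  have hsmul : ∀ (c : ℂ) x y, h (c • x) y = star c * h x y := by
    intro c x y
    rw [← hh, map_smul, smul_eq_mul, star_mul', hh]
  have hadd : ∀ x x' y, h (x + x') y = h x y + h x' y := by
    intro x x' y
    rw [← hh, map_add, star_add, hh, hh]
  have hscale : ∀ v, h v v ≠ 0 → ∃ (c : ℂ) (ε : ℝ), c ≠ 0 ∧ (ε = 1 ∨ ε = -1) ∧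
      h (c • v) (c • v) = ε := by
    intro v hv
    set t := (h v v).re
    have ht : h v v = t := Complex.ext (by simp [t]) (by simp [hreal])
    have ht0 : t ≠ 0 := by rintro h0; apply hv; rw [ht, h0]; simp
    have habs : 0 < |t| := abs_pos.2 ht0
    refine ⟨((Real.sqrt |t|)⁻¹ : ℝ), t / |t|, ?_, ?_, ?_⟩
    · exact_mod_cast (inv_pos.2 (Real.sqrt_pos.2 habs)).ne'
    · rcases abs_cases t with ⟨h1, h2⟩ | ⟨h1, h2⟩
      · left; rw [h1]; exact div_self ht0
      · right; rw [h1]; field_simp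
    · rw [hsmul, map_smul, ht, smul_eq_mul]
      have h1 : (Real.sqrt |t|)⁻¹ * ((Real.sqrt |t|)⁻¹ * t) = t / |t| := by
        rw [← mul_assoc, ← mul_inv, Real.mul_self_sqrt habs.le]
        field_simp
      rw [← h1]
      simp
  -- Polarization: if the form vanished on the diagonal, `x + y` and `x + i y` would kill the real
  -- and imaginary parts of `h y x`.
  obtain ⟨v, hv⟩ : ∃ v, h v v ≠ 0 := by
    by_contra! hcon
    obtain ⟨y, hy⟩ := hnd (1, 0) (by simp)
    apply hy
    set x : ℂ × ℂ := (1, 0)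
    have h1 := hcon (x + y)
    have h2 := hcon (x + Complex.I • y)
    rw [hadd, map_add, map_add, hcon, hcon] at h1 h2
    rw [hsmul, map_smul, ← hh y x] at h2
    rw [← hh y x] at h1
    have r1 := congrArg Complex.re h1
    have r2 := congrArg Complex.re h2
    simp at r1 r2
    apply Complex.ext <;> simp <;> linarith
  -- An explicit generator of the kernel of the functional `h v`, that is, of the orthogonal
  -- complement of `v`.
  set w : ℂ × ℂ := (-h v (0, 1), h v (1, 0)) with hw
  have hdec : ∀ y : ℂ × ℂ, y = y.1 • ((1, 0) : ℂ × ℂ) + y.2 • ((0, 1) : ℂ × ℂ) := by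
    intro y; ext <;> simp
  have hvw : h v w = 0 := by
    rw [hdec w, map_add, map_smul, map_smul]
    simp [hw]
    ring
  have hw0 : w ≠ 0 := by
    intro h0
    apply hv
    have h1 := congrArg Prod.fst h0
    have h2 := congrArg Prod.snd h0
    simp [hw] at h1 h2
    rw [hdec v, map_add, map_smul, map_smul, ← hdec v, h1, h2]
    simp
  have hwv : h w v = 0 := by rw [← hh, hvw, star_zero]
  have hindep : ∀ a b : ℂ, a • v + b • w = 0 → a = 0 ∧ b = 0 := by
    intro a b hab
    have h1 := congrArg (h v) hab
    rw [map_add, map_smul, map_smul, hvw, map_zero] at h1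
    have ha : a = 0 := by simpa [hv] using h1
    rw [ha, zero_smul, zero_add] at hab
    exact ⟨ha, (smul_eq_zero.1 hab).resolve_right hw0⟩
  -- Otherwise `w` would be orthogonal to both `v` and `w`, hence to everything, against
  -- nondegeneracy.
  have hww : h w w ≠ 0 := by
    intro h0
    obtain ⟨y, hy⟩ := hnd w hw0
    apply hy
    let S : ℂ × ℂ →ₗ[ℂ] ℂ × ℂ :=
      (LinearMap.toSpanSingleton ℂ _ v).coprod (LinearMap.toSpanSingleton ℂ _ w)
    have hS : Function.Injective S := by
      rw [← LinearMap.ker_eq_bot, LinearMap.ker_eq_bot']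
      intro x hx
      have := hindep x.1 x.2 (by simpa [S] using hx)
      exact Prod.ext this.1 this.2
    obtain ⟨c, rfl⟩ := (LinearMap.injective_iff_surjective.1 hS) y
    have : S c = c.1 • v + c.2 • w := by simp [S]
    rw [this, hadd, hsmul, hsmul, hvw, h0]
    simp
  obtain ⟨c₁, ε₁, hc₁, hε₁, h₁⟩ := hscale v hv
  obtain ⟨c₂, ε₂, hc₂, hε₂, h₂⟩ := hscale w hww
  -- Only the relative sign `ε = ε₁ ε₂` survives in the normal form; the common factor `ε₀ = ε₁` is
  -- absorbed later by the last coordinate.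
  refine ⟨c₁ • v, c₂ • w, ε₁, ε₁ * ε₂, hε₁, ?_, h₁, ?_, ?_, ?_⟩
  · rcases hε₁ with rfl | rfl <;> rcases hε₂ with rfl | rfl <;> simp
  · rw [h₂]
    rcases hε₁ with rfl | rfl <;> simp
  · rw [hsmul, map_smul, hvw]; simp
  · intro a b hab
    rw [smul_smul, smul_smul] at hab
    have := hindep _ _ hab
    simpa [hc₁, hc₂] using this

end Diagonalization

/-! ### Two-jets of germs in normal coordinates -/

section Normal

/-- `F (z, ζ, u)` is a Hermitian analytic germ at the origin of `ℂ² × ℂ² × ℂ` that vanishes for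
`z = 0` and for `ζ = 0`. -/
structure IsNormalGerm (F : (ℂ × ℂ) × (ℂ × ℂ) × ℂ → ℂ) : Prop where
  analyticAt : AnalyticAt ℂ F 0
  right : ∀ᶠ x in 𝓝 (0 : (ℂ × ℂ) × ℂ), F (x.1, 0, x.2) = 0
  left : ∀ᶠ x in 𝓝 (0 : (ℂ × ℂ) × ℂ), F (0, x.1, x.2) = 0
  hermitian : ∀ᶠ y in 𝓝 (0 : (ℂ × ℂ) × (ℂ × ℂ) × ℂ),
    star (F (star y.2.1, star y.1, star y.2.2)) = F y

namespace IsNormalGerm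

variable {F : (ℂ × ℂ) × (ℂ × ℂ) × ℂ → ℂ}

/-- The inclusion `(z, u) ↦ (z, 0, u)`. -/
noncomputable def inclZ : (ℂ × ℂ) × ℂ →L[ℂ] (ℂ × ℂ) × (ℂ × ℂ) × ℂ :=
  (ContinuousLinearMap.fst ℂ (ℂ × ℂ) ℂ).prod
    ((0 : (ℂ × ℂ) × ℂ →L[ℂ] ℂ × ℂ).prod (.snd ℂ (ℂ × ℂ) ℂ))

/-- The inclusion `(ζ, u) ↦ (0, ζ, u)`. -/
noncomputable def inclZeta : (ℂ × ℂ) × ℂ →L[ℂ] (ℂ × ℂ) × (ℂ × ℂ) × ℂ :=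
  (0 : (ℂ × ℂ) × ℂ →L[ℂ] ℂ × ℂ).prod (ContinuousLinearMap.id ℂ ((ℂ × ℂ) × ℂ))

theorem jet_right (hF : IsNormalGerm F) : F 0 = 0 ∧
    (∀ v : (ℂ × ℂ) × ℂ, fderiv ℂ F 0 (v.1, 0, v.2) = 0) ∧
      ∀ v w : (ℂ × ℂ) × ℂ, fderiv ℂ (fderiv ℂ F) 0 (v.1, 0, v.2) (w.1, 0, w.2) = 0 :=
  jet_eq_zero_of_comp_eq_zero hF.analyticAt inclZ hF.right

theorem jet_left (hF : IsNormalGerm F) : F 0 = 0 ∧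
    (∀ v : (ℂ × ℂ) × ℂ, fderiv ℂ F 0 (0, v.1, v.2) = 0) ∧
      ∀ v w : (ℂ × ℂ) × ℂ, fderiv ℂ (fderiv ℂ F) 0 (0, v.1, v.2) (0, w.1, w.2) = 0 :=
  jet_eq_zero_of_comp_eq_zero hF.analyticAt inclZeta hF.left

theorem fderiv_eq_zero (hF : IsNormalGerm F) : fderiv ℂ F 0 = 0 := by
  refine ContinuousLinearMap.ext fun v => ?_
  have h : v = (v.1, 0, v.2.2) + (0, v.2.1, 0) := by simp
  rw [h, map_add, hF.jet_right.2.1 (v.1, v.2.2), hF.jet_left.2.1 (v.2.1, 0)]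
  simp

/-- The mixed part of the Hessian of a normal germ. -/
theorem hessian_mixed (hF : IsNormalGerm F) (α β : ℂ × ℂ) (u u' : ℂ) :
    fderiv ℂ (fderiv ℂ F) 0 (0, β, u) (α, 0, u') =
      fderiv ℂ (fderiv ℂ F) 0 (0, β, 0) (α, 0, 0) := by
  have h1 : ((0, β, u) : (ℂ × ℂ) × (ℂ × ℂ) × ℂ) = (0, β, 0) + (0, 0, u) := by simp
  have h2 : ((α, 0, u') : (ℂ × ℂ) × (ℂ × ℂ) × ℂ) = (α, 0, 0) + (0, 0, u') := by simp
  -- Each extra term involves only directions inside `z = 0` or inside `ζ = 0`, where `F` vanishes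
  -- identically.
  have e1 := hF.jet_left.2.2 (β, 0) (0, u')
  have e2 := hF.jet_right.2.2 (0, u) (α, 0)
  have e3 := hF.jet_right.2.2 (0, u) (0, u')
  rw [h1, map_add, add_apply, h2, map_add, map_add]
  dsimp only at e1 e2 e3
  rw [e1, e2, e3]
  ring

/-- The Hermitian identity for `F`, differentiated twice at the origin. It makes the mixed block,
with one argument conjugated, a Hermitian form on `ℂ²`. -/
theorem hessian_star (hF : IsNormalGerm F) (α β : ℂ × ℂ) :
    star (fderiv ℂ (fderiv ℂ F) 0 (0, star β, 0) (α, 0, 0)) =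
      fderiv ℂ (fderiv ℂ F) 0 (0, star α, 0) (β, 0, 0) := by
  have : NormedStarGroup ((ℂ × ℂ) × ℂ) := Prod.normedStarGroup
  have : NormedStarGroup ((ℂ × ℂ) × (ℂ × ℂ) × ℂ) := Prod.normedStarGroup
  let S : (ℂ × ℂ) × (ℂ × ℂ) × ℂ →L[ℂ] (ℂ × ℂ) × (ℂ × ℂ) × ℂ :=
    ((ContinuousLinearMap.fst ℂ (ℂ × ℂ) ℂ).comp (.snd ℂ (ℂ × ℂ) ((ℂ × ℂ) × ℂ))).prod
      ((ContinuousLinearMap.fst ℂ (ℂ × ℂ) ((ℂ × ℂ) × ℂ)).prod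
        ((ContinuousLinearMap.snd ℂ (ℂ × ℂ) ℂ).comp (.snd ℂ (ℂ × ℂ) ((ℂ × ℂ) × ℂ))))
  have hS : ∀ y, S y = (y.2.1, y.1, y.2.2) := fun _ => rfl
  have hFS : AnalyticAt ℂ (fun y => F (S y)) 0 :=
    AnalyticAt.comp_of_eq (g := F) hF.analyticAt (S.analyticAt 0) (map_zero S)
  have h1 : (fun y => star ((fun x => F (S x)) (star y))) =ᶠ[𝓝 0] F := by
    filter_upwards [hF.hermitian] with y hy
    exact hy
  have key : ∀ v w, fderiv ℂ (fderiv ℂ F) 0 v w =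
      star (fderiv ℂ (fderiv ℂ F) 0 (S (star v)) (S (star w))) := by
    intro v w
    rw [← fderiv_fderiv_comp_apply hF.analyticAt, ← fderiv_fderiv_star_star hFS,
      h1.fderiv.fderiv_eq]
  rw [key (0, star α, 0) (β, 0, 0), fderiv_fderiv_symm hF.analyticAt]
  simp only [hS, Prod.star_def, star_star, star_zero]

end IsNormalGerm

end Normal

/-! ### Transfer of Levi nondegeneracy to normal coordinates -/

/-- In normal coordinates, Levi nondegeneracy means nondegeneracy of the mixed Hessian of the
graphing function. -/
theorem HasLeviRank.normal_germ_nondegenerate {M : Set CThree} {p : CThree}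
    (hL : HasLeviRank M p 2) (hp : p ∈ M) {Ψ : OpenPartialHomeomorph CThree ((ℂ × ℂ) × ℂ)}
    {F : (ℂ × ℂ) × (ℂ × ℂ) × ℂ → ℂ} (hpΨ : p ∈ Ψ.source) (hΨp : Ψ p = 0)
    (hΨ : AnalyticAt ℂ Ψ p) (hΨs : AnalyticAt ℂ Ψ.symm 0) (hF : IsNormalGerm F)
    (hM : ∀ᶠ x in 𝓝 (0 : (ℂ × ℂ) × ℂ),
        Ψ.symm x ∈ M ↔ F (x.1, star x.1, (x.2.re : ℂ)) = (x.2.im : ℂ)) (α : ℂ × ℂ) (hα : α ≠ 0) :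
    ∃ β : ℂ × ℂ, fderiv ℂ (fderiv ℂ F) 0 (0, β, 0) (α, 0, 0) ≠ 0 := by
  have : NormedStarGroup ((ℂ × ℂ) × ℂ) := Prod.normedStarGroup
  set sΨ : CThree → ((ℂ × ℂ) × ℂ) := fun ξ => star (Ψ (star ξ)) with hsΨdef
  have hsΨ : AnalyticAt ℂ sΨ (star p) := AnalyticAt.star_star (by rwa [star_star])
  have hsΨp : sΨ (star p) = 0 := by simp [hsΨdef, hΨp]
  set Ψ' := fderiv ℂ Ψ p
  have hsurj : ∀ x : ((ℂ × ℂ) × ℂ), ∃ a, Ψ' a = x := by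
    intro x
    have h1 : HasFDerivAt (Ψ ∘ Ψ.symm) (Ψ'.comp (fderiv ℂ Ψ.symm 0)) 0 := by
      have hps : Ψ.symm 0 = p := by rw [← hΨp]; exact Ψ.left_inv hpΨ
      refine HasFDerivAt.comp 0 ?_ hΨs.differentiableAt.hasFDerivAt
      rw [hps]; exact hΨ.differentiableAt.hasFDerivAt
    have h2 : (Ψ ∘ Ψ.symm) =ᶠ[𝓝 0] id := by
      have : Ψ.target ∈ 𝓝 (0 : ((ℂ × ℂ) × ℂ)) := Ψ.open_target.mem_nhds (hΨp ▸ Ψ.map_source hpΨ)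
      filter_upwards [this] with x hx
      exact Ψ.right_inv hx
    have h3 := h1.unique ((hasFDerivAt_id (0 : ((ℂ × ℂ) × ℂ))).congr_of_eventuallyEq h2)
    exact ⟨fderiv ℂ Ψ.symm 0 x, congrArg (fun A : ((ℂ × ℂ) × ℂ) →L[ℂ] ((ℂ × ℂ) × ℂ) => A x) h3⟩
  let N : ((ℂ × ℂ) × ℂ) × ((ℂ × ℂ) × ℂ) →L[ℂ] (ℂ × ℂ) × (ℂ × ℂ) × ℂ :=
    ((ContinuousLinearMap.fst ℂ (ℂ × ℂ) ℂ).comp (.fst ℂ ((ℂ × ℂ) × ℂ) ((ℂ × ℂ) × ℂ))).prod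
      (((ContinuousLinearMap.fst ℂ (ℂ × ℂ) ℂ).comp (.snd ℂ ((ℂ × ℂ) × ℂ) ((ℂ × ℂ) × ℂ))).prod
        ((1 / 2 : ℂ) • ((ContinuousLinearMap.snd ℂ (ℂ × ℂ) ℂ).comp (.fst ℂ ((ℂ × ℂ) × ℂ) ((ℂ × ℂ) × ℂ)) +
          (ContinuousLinearMap.snd ℂ (ℂ × ℂ) ℂ).comp (.snd ℂ ((ℂ × ℂ) × ℂ) ((ℂ × ℂ) × ℂ)))))
  have hN : ∀ y : ((ℂ × ℂ) × ℂ) × ((ℂ × ℂ) × ℂ), N y = (y.1.1, y.2.1, (1 / 2 : ℂ) * (y.1.2 + y.2.2)) := fun _ => rfl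
  let K : ((ℂ × ℂ) × ℂ) × ((ℂ × ℂ) × ℂ) →L[ℂ] ℂ := (1 / (2 * Complex.I)) •
    ((ContinuousLinearMap.snd ℂ (ℂ × ℂ) ℂ).comp (.fst ℂ ((ℂ × ℂ) × ℂ) ((ℂ × ℂ) × ℂ)) -
      (ContinuousLinearMap.snd ℂ (ℂ × ℂ) ℂ).comp (.snd ℂ ((ℂ × ℂ) × ℂ) ((ℂ × ℂ) × ℂ)))
  have hK : ∀ y : ((ℂ × ℂ) × ℂ) × ((ℂ × ℂ) × ℂ), K y = (1 / (2 * Complex.I)) * (y.1.2 - y.2.2) := fun _ => rfl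
  set κ : CThree × CThree → ((ℂ × ℂ) × ℂ) × ((ℂ × ℂ) × ℂ) := fun y => (Ψ y.1, sΨ y.2) with hκdef
  have hκ : AnalyticAt ℂ κ (p, star p) := by
    have h1 : AnalyticAt ℂ (fun y : CThree × CThree => Ψ y.1) (p, star p) :=
      AnalyticAt.comp (g := Ψ) (f := Prod.fst) hΨ analyticAt_fst
    have h2 : AnalyticAt ℂ (fun y : CThree × CThree => sΨ y.2) (p, star p) :=
      AnalyticAt.comp (g := sΨ) (f := Prod.snd) hsΨ analyticAt_snd
    exact h1.prod h2
  have hκ0 : κ (p, star p) = 0 := by simp [hκdef, hΨp, hsΨp]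
  have hG₀ : AnalyticAt ℂ (fun y : ((ℂ × ℂ) × ℂ) × ((ℂ × ℂ) × ℂ) => K y - F (N y)) 0 :=
    (K.analyticAt 0).sub (AnalyticAt.comp_of_eq (g := F) hF.analyticAt (N.analyticAt 0) (map_zero N))
  set G : CThree × CThree → ℂ := fun y => K (κ y) - F (N (κ y)) with hGdef
  have hG : AnalyticAt ℂ G (p, star p) := AnalyticAt.comp_of_eq (g := fun y : ((ℂ × ℂ) × ℂ) × ((ℂ × ℂ) × ℂ) => K y - F (N y)) hG₀ hκ hκ0
  -- With the first variable frozen at `p`, the chart enters only through `Ψ'`. Differentiating this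
  -- formula in `ξ` gives the mixed Hessian without second derivatives of `Ψ`.
  have hGd : ∀ᶠ ξ in 𝓝 (star p), ∀ a, fderiv ℂ G (p, ξ) (a, 0) =
      K (Ψ' a, 0) - fderiv ℂ F (N (0, sΨ ξ)) (N (Ψ' a, 0)) := by
    have hFe := hF.analyticAt.eventually_analyticAt.comp_continuousAt_zero
      (φ := fun x : (ℂ × ℂ) × ℂ => N (0, x)) (by fun_prop) (map_zero N)
    have hFe' := hsΨ.continuousAt.eventually (by rw [hsΨp]; exact hFe)
    filter_upwards [hsΨ.eventually_analyticAt, hFe'] with ξ h1 h2 a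
    have hκξ : κ (p, ξ) = (0, sΨ ξ) := by simp [hκdef, hΨp]
    have d1 : HasFDerivAt (fun y : CThree × CThree => Ψ y.1) _ (p, ξ) :=
      HasFDerivAt.comp (g := Ψ) (f := Prod.fst) (p, ξ) hΨ.differentiableAt.hasFDerivAt hasFDerivAt_fst
    have d2 : HasFDerivAt (fun y : CThree × CThree => sΨ y.2) _ (p, ξ) :=
      HasFDerivAt.comp (g := sΨ) (f := Prod.snd) (p, ξ) h1.differentiableAt.hasFDerivAt hasFDerivAt_snd
    have d3 : HasFDerivAt κ _ (p, ξ) := d1.prodMk d2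
    have d4 : HasFDerivAt F (fderiv ℂ F (N (0, sΨ ξ))) (N (κ (p, ξ))) := by
      rw [hκξ]; exact h2.differentiableAt.hasFDerivAt
    have d5 : HasFDerivAt G _ (p, ξ) :=
      (K.hasFDerivAt.comp (p, ξ) d3).sub (d4.comp (p, ξ) (N.hasFDerivAt.comp (p, ξ) d3))
    rw [d5.fderiv]
    simp [Ψ']
  have hGdiag : ∀ q, G (q, star q) =
      ((Ψ q).2.im : ℂ) - F ((Ψ q).1, star (Ψ q).1, ((Ψ q).2.re : ℂ)) := by
    intro q
    simp only [hGdef, hκdef, hsΨdef, star_star, hK, hN]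
    rw [Complex.re_eq_add_conj, Complex.im_eq_sub_conj]
    simp only [Prod.snd_star, Prod.fst_star, Complex.star_def]
    congr 1
    · ring
    · congr 3; ring
  have hE : IsLocalEquation G M p := by
    refine ⟨hp, hG, ?_, ?_, ?_⟩
    · have e := hΨ.continuousAt.eventually (p := fun x : ((ℂ × ℂ) × ℂ) =>
        star (F (star (star x.1), star x.1, star (x.2.re : ℂ))) =
          F (x.1, star x.1, (x.2.re : ℂ))) (by
        rw [hΨp]
        exact hF.hermitian.comp_continuousAt_zero
          (φ := fun x : ((ℂ × ℂ) × ℂ) => (x.1, star x.1, (x.2.re : ℂ))) (by fun_prop) (by simp))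
      filter_upwards [e] with q hq
      rw [hGdiag]
      have hr : star (((Ψ q).2.re : ℝ) : ℂ) = ((Ψ q).2.re : ℂ) := Complex.conj_ofReal _
      rw [star_star, hr] at hq
      have := Complex.conj_eq_iff_im.1 hq
      rw [Complex.sub_im, this]
      simp
    · have e := hΨ.continuousAt.eventually (by rw [hΨp]; exact hM)
      filter_upwards [e, Ψ.open_source.mem_nhds hpΨ] with q hq hqs
      rw [Ψ.left_inv hqs] at hq
      rw [hq, hGdiag, sub_eq_zero, eq_comm]
    · obtain ⟨a, ha⟩ := hsurj (0, 1)
      refine ⟨a, ?_⟩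
      rw [hGd.self_of_nhds, ha, hsΨp]
      have : N ((0 : ((ℂ × ℂ) × ℂ)), (0 : ((ℂ × ℂ) × ℂ))) = 0 := map_zero N
      rw [this, hF.fderiv_eq_zero, hK]
      simp
  obtain ⟨a, ha⟩ := hsurj (α, 0)
  have ha0 : a ≠ 0 := by
    rintro rfl
    rw [map_zero] at ha
    exact hα (congrArg Prod.fst ha).symm
  have hNa : N (Ψ' a, 0) = (α, 0, 0) := by rw [ha, hN]; simp
  have hKa : K (Ψ' a, 0) = 0 := by rw [ha, hK]; simp
  have hNz : N ((0 : ((ℂ × ℂ) × ℂ)), (0 : ((ℂ × ℂ) × ℂ))) = 0 := map_zero N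
  obtain ⟨b, -, hb⟩ := hL.exists_hessian_ne_zero hE (a := a) (by
    rw [hGd.self_of_nhds, hKa, hsΨp, hNz, hF.fderiv_eq_zero]
    simp) ha0
  set b' := fderiv ℂ sΨ (star p) b
  refine ⟨b'.1, ?_⟩
  have e1 : HasFDerivAt (fun ξ => fderiv ℂ G (p, ξ) (a, 0)) _ (star p) :=
    HasFDerivAt.comp (g := fun y => fderiv ℂ G y (a, 0)) (star p)
      (hG.fderiv.differentiableAt.clm_apply (differentiableAt_const (a, 0))).hasFDerivAt
      (hasFDerivAt_prodMk_right p (star p))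
  have e2 : HasFDerivAt (fun ξ => K (Ψ' a, 0) - fderiv ℂ F (N (0, sΨ ξ)) (N (Ψ' a, 0))) _ (star p) :=
    HasFDerivAt.const_sub (c := K (Ψ' a, 0)) (HasFDerivAt.comp
      (g := fun x : (ℂ × ℂ) × ℂ => fderiv ℂ F (N (0, x)) (N (Ψ' a, 0))) (star p)
      (DifferentiableAt.hasFDerivAt (by
        rw [hsΨp]
        refine DifferentiableAt.comp (g := fun y => fderiv ℂ F y (N (Ψ' a, 0)))
          (f := fun x : (ℂ × ℂ) × ℂ => N (0, x)) _ ?_ (by fun_prop)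
        rw [hNz]
        exact hF.analyticAt.fderiv.differentiableAt.clm_apply (differentiableAt_const _)))
      hsΨ.differentiableAt.hasFDerivAt)
  have e3 := e1.unique (e2.congr_of_eventuallyEq (hGd.mono fun ξ h => h a))
  have e4 := congrArg (fun A : CThree →L[ℂ] ℂ => A b) e3
  have e5 : fderiv ℂ (fun y => fderiv ℂ G y (a, 0)) (p, star p) (0, b) =
      -fderiv ℂ (fun x : (ℂ × ℂ) × ℂ => fderiv ℂ F (N (0, x)) (N (Ψ' a, 0))) (sΨ (star p)) b' := e4
  rw [fderiv_fderiv_apply hG, hsΨp, fderiv_comp_zero_apply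
    (H := fun y => fderiv ℂ F y (N (Ψ' a, 0))) (φ := fun x : (ℂ × ℂ) × ℂ => N (0, x))
    (L := N.comp (.inr ℂ ((ℂ × ℂ) × ℂ) ((ℂ × ℂ) × ℂ)))
    (hF.analyticAt.fderiv.differentiableAt.clm_apply (differentiableAt_const _))
    (ContinuousLinearMap.hasFDerivAt (N.comp (.inr ℂ ((ℂ × ℂ) × ℂ) ((ℂ × ℂ) × ℂ)))) hNz,
    fderiv_fderiv_apply hF.analyticAt, hNa] at e5
  rw [e5] at hb
  -- The direction `b'` may have a component along the last coordinate; `hessian_mixed` discards it.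
  have hNb : N.comp (.inr ℂ ((ℂ × ℂ) × ℂ) ((ℂ × ℂ) × ℂ)) b' = (0, b'.1, (1 / 2 : ℂ) * b'.2) := by
    simp [hN]
  rw [hNb, hF.hessian_mixed] at hb
  exact neg_ne_zero.1 hb

/-! ### Hessians of the quadratic model -/

section HessianAlgebra

variable {A : Type*} [NormedAddCommGroup A] [NormedSpace ℂ A]

theorem fderiv_fderiv_const_mul_sub {f g : A → ℂ} (hf : AnalyticAt ℂ f 0) (hg : AnalyticAt ℂ g 0)
    (c : ℂ) (v w : A) : fderiv ℂ (fderiv ℂ fun x => c * f x - g x) 0 v w =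
      c * fderiv ℂ (fderiv ℂ f) 0 v w - fderiv ℂ (fderiv ℂ g) 0 v w := by
  have h1 : (fun s => fderiv ℂ (fun x => c * f x - g x) s w) =ᶠ[𝓝 0]
      fun s => c * fderiv ℂ f s w - fderiv ℂ g s w := by
    filter_upwards [hf.eventually_analyticAt, hg.eventually_analyticAt] with s h1 h2
    have h : HasFDerivAt (fun x => c * f x - g x) _ s :=
      (h1.differentiableAt.hasFDerivAt.const_mul c).sub h2.differentiableAt.hasFDerivAt
    rw [h.fderiv]
    simp
  have h2 : HasFDerivAt (fun s => c * fderiv ℂ f s w - fderiv ℂ g s w) _ 0 :=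
    ((hf.fderiv.differentiableAt.clm_apply (differentiableAt_const w)).hasFDerivAt.const_mul c).sub
      (hg.fderiv.differentiableAt.clm_apply (differentiableAt_const w)).hasFDerivAt
  have ha : AnalyticAt ℂ (fun x => c * f x - g x) 0 := (analyticAt_const.mul hf).sub hg
  rw [← fderiv_fderiv_apply ha, h1.fderiv_eq, h2.fderiv,
    ← fderiv_fderiv_apply hf, ← fderiv_fderiv_apply hg]
  simp

theorem fderiv_fderiv_mul_add_mul (k l m n : A →L[ℂ] ℂ) (c : ℂ) (v w : A) :
    fderiv ℂ (fderiv ℂ fun x => k x * l x + c * (m x * n x)) 0 v w =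
      k v * l w + k w * l v + c * (m v * n w + m w * n v) := by
  have ha : AnalyticAt ℂ (fun x => k x * l x + c * (m x * n x)) 0 := by
    have := k.analyticAt 0
    have := l.analyticAt 0
    have := m.analyticAt 0
    have := n.analyticAt 0
    fun_prop
  have h1 : (fun s => fderiv ℂ (fun x => k x * l x + c * (m x * n x)) s w) =
      fun s => (l w • k + k w • l + c • (n w • m + m w • n)) s := by
    ext s
    have h : HasFDerivAt (fun x => k x * l x + c * (m x * n x)) _ s :=
      (k.hasFDerivAt.mul l.hasFDerivAt).add ((m.hasFDerivAt.mul n.hasFDerivAt).const_mul c)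
    rw [h.fderiv]
    simp
    ring
  rw [← fderiv_fderiv_apply ha, h1, ContinuousLinearMap.fderiv]
  simp
  ring

end HessianAlgebra

/-! ### The remainder in a diagonalizing frame -/

namespace IsNormalGerm

/-- The linear change `(z₁, z₂, ζ₁, ζ₂, u) ↦ (z₁ e₁ + z₂ e₂, ζ₁ ē₁ + ζ₂ ē₂, ε₀ u)`. -/
noncomputable def frameMap (e₁ e₂ : ℂ × ℂ) (ε₀ : ℝ) :
    ℂ × ℂ × ℂ × ℂ × ℂ →L[ℂ] (ℂ × ℂ) × (ℂ × ℂ) × ℂ :=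
  LinearMap.toContinuousLinearMap
    { toFun := fun x => (x.1 • e₁ + x.2.1 • e₂, x.2.2.1 • star e₁ + x.2.2.2.1 • star e₂,
        (ε₀ : ℂ) * x.2.2.2.2)
      map_add' := by
        intro x y
        refine Prod.ext ?_ (Prod.ext ?_ ?_)
        · simp only [Prod.fst_add, Prod.snd_add]; module
        · simp only [Prod.fst_add, Prod.snd_add]; module
        · simp only [Prod.snd_add]; ring
      map_smul' := by
        intro c x
        refine Prod.ext ?_ (Prod.ext ?_ ?_)
        · simp only [Prod.smul_fst, Prod.smul_snd, smul_eq_mul, RingHom.id_apply]; module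
        · simp only [Prod.smul_fst, Prod.smul_snd, smul_eq_mul, RingHom.id_apply]; module
        · simp only [Prod.smul_snd, smul_eq_mul, RingHom.id_apply]; ring }

theorem frameMap_apply (e₁ e₂ : ℂ × ℂ) (ε₀ : ℝ) (x : ℂ × ℂ × ℂ × ℂ × ℂ) :
    frameMap e₁ e₂ ε₀ x = (x.1 • e₁ + x.2.1 • e₂, x.2.2.1 • star e₁ + x.2.2.2.1 • star e₂,
        (ε₀ : ℂ) * x.2.2.2.2) := rfl

/-- The graphing function in the frame `(e₁, e₂)`, minus its quadratic part. -/
noncomputable def remainder (F : (ℂ × ℂ) × (ℂ × ℂ) × ℂ → ℂ) (e₁ e₂ : ℂ × ℂ) (ε₀ ε : ℝ)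
    (x : ℂ × ℂ × ℂ × ℂ × ℂ) : ℂ :=
  ε₀ * F (frameMap e₁ e₂ ε₀ x) - (x.1 * x.2.2.1 + ε * (x.2.1 * x.2.2.2.1))

/-- Both `F` and the quadratic model vanish for `z = 0` and for `ζ = 0`, so the remainder does too
and its two-jet has at most a mixed part. That part cancels because the frame diagonalizes the mixed
Hessian and `ε₀ ^ 2 = 1`. -/
theorem exists_isNormalRemainder {F : (ℂ × ℂ) × (ℂ × ℂ) × ℂ → ℂ} (hF : IsNormalGerm F)
    {e₁ e₂ : ℂ × ℂ} {ε₀ ε : ℝ} (hε₀ : ε₀ = 1 ∨ ε₀ = -1)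
    (h₁ : fderiv ℂ (fderiv ℂ F) 0 (0, star e₁, 0) (e₁, 0, 0) = ε₀)
    (h₂ : fderiv ℂ (fderiv ℂ F) 0 (0, star e₂, 0) (e₂, 0, 0) = ε₀ * ε)
    (h₁₂ : fderiv ℂ (fderiv ℂ F) 0 (0, star e₁, 0) (e₂, 0, 0) = 0) :
    ∃ δ > 0, IsNormalRemainder (remainder F e₁ e₂ ε₀ ε) δ := by
  have h₂₁ : fderiv ℂ (fderiv ℂ F) 0 (0, star e₂, 0) (e₁, 0, 0) = 0 := by
    rw [← hF.hessian_star, h₁₂, star_zero]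
  set T := frameMap e₁ e₂ ε₀
  have hT : ∀ x, T x = (x.1 • e₁ + x.2.1 • e₂, x.2.2.1 • star e₁ + x.2.2.2.1 • star e₂,
        (ε₀ : ℂ) * x.2.2.2.2) := frameMap_apply e₁ e₂ ε₀
  set R := remainder F e₁ e₂ ε₀ ε
  have hR : ∀ x, R x = ε₀ * F (T x) - (x.1 * x.2.2.1 + ε * (x.2.1 * x.2.2.2.1)) := fun _ => rfl
  have hFT : AnalyticAt ℂ (fun x => F (T x)) 0 :=
    AnalyticAt.comp_of_eq (g := F) hF.analyticAt (T.analyticAt 0) (map_zero T)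
  have hQ : AnalyticAt ℂ
      (fun x : ℂ × ℂ × ℂ × ℂ × ℂ => x.1 * x.2.2.1 + ε * (x.2.1 * x.2.2.2.1)) 0 := by fun_prop
  have hRa : AnalyticAt ℂ R 0 := (analyticAt_const.mul hFT).sub hQ
  let J₁ : ℂ × ℂ × ℂ →L[ℂ] ℂ × ℂ × ℂ × ℂ × ℂ := LinearMap.toContinuousLinearMap
    { toFun := fun x => (x.1, x.2.1, 0, 0, x.2.2)
      map_add' := by intro x y; simp
      map_smul' := by intro x y; simp }
  let J₂ : ℂ × ℂ × ℂ →L[ℂ] ℂ × ℂ × ℂ × ℂ × ℂ := LinearMap.toContinuousLinearMap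
    { toFun := fun x => (0, 0, x)
      map_add' := by intro x y; simp
      map_smul' := by intro x y; simp }
  have hJ₁ : ∀ x, J₁ x = (x.1, x.2.1, 0, 0, x.2.2) := fun _ => rfl
  have hJ₂ : ∀ x, J₂ x = (0, 0, x) := fun _ => rfl
  have z₁ : ∀ᶠ x in 𝓝 (0 : ℂ × ℂ × ℂ), R (J₁ x) = 0 := by
    filter_upwards [hF.right.comp_continuousAt_zero
      (φ := fun x : ℂ × ℂ × ℂ => (x.1 • e₁ + x.2.1 • e₂, (ε₀ : ℂ) * x.2.2)) (by fun_prop)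
      (by simp)] with x hx
    have : T (J₁ x) = (x.1 • e₁ + x.2.1 • e₂, 0, (ε₀ : ℂ) * x.2.2) := by rw [hT, hJ₁]; simp
    rw [hR, this, hx, hJ₁]
    simp
  have z₂ : ∀ᶠ x in 𝓝 (0 : ℂ × ℂ × ℂ), R (J₂ x) = 0 := by
    filter_upwards [hF.left.comp_continuousAt_zero
      (φ := fun x : ℂ × ℂ × ℂ => (x.1 • star e₁ + x.2.1 • star e₂, (ε₀ : ℂ) * x.2.2)) (by fun_prop)
      (by simp)] with x hx
    have : T (J₂ x) = (0, x.1 • star e₁ + x.2.1 • star e₂, (ε₀ : ℂ) * x.2.2) := by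
      rw [hT, hJ₂]; simp
    rw [hR, this, hx, hJ₂]
    simp
  obtain ⟨hR0, hR1, hR2⟩ := jet_eq_zero_of_comp_eq_zero hRa J₁ z₁
  obtain ⟨-, hR1', hR2'⟩ := jet_eq_zero_of_comp_eq_zero hRa J₂ z₂
  have hdec : ∀ v : ℂ × ℂ × ℂ × ℂ × ℂ,
      v = J₁ (v.1, v.2.1, v.2.2.2.2) + J₂ (v.2.2.1, v.2.2.2.1, 0) := by
    intro v; simp [hJ₁, hJ₂]
  have hRd : fderiv ℂ R 0 = 0 := by
    refine ContinuousLinearMap.ext fun v => ?_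
    rw [hdec v, map_add, hR1, hR1', add_zero]
    rfl
  have hmix : ∀ v w, fderiv ℂ (fderiv ℂ R) 0 (J₂ v) (J₁ w) = 0 := by
    intro v w
    have e1 : fderiv ℂ (fderiv ℂ R) 0 (J₂ v) (J₁ w) = _ :=
      fderiv_fderiv_const_mul_sub hFT hQ ε₀ (J₂ v) (J₁ w)
    let π₁ : ℂ × ℂ × ℂ × ℂ × ℂ →L[ℂ] ℂ := .fst ℂ _ _
    let π₂ : ℂ × ℂ × ℂ × ℂ × ℂ →L[ℂ] ℂ :=
      (ContinuousLinearMap.fst ℂ ℂ (ℂ × ℂ × ℂ)).comp (.snd ℂ ℂ (ℂ × ℂ × ℂ × ℂ))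
    let π₃ : ℂ × ℂ × ℂ × ℂ × ℂ →L[ℂ] ℂ := (ContinuousLinearMap.fst ℂ ℂ (ℂ × ℂ)).comp
      ((ContinuousLinearMap.snd ℂ ℂ (ℂ × ℂ × ℂ)).comp (.snd ℂ ℂ (ℂ × ℂ × ℂ × ℂ)))
    let π₄ : ℂ × ℂ × ℂ × ℂ × ℂ →L[ℂ] ℂ := (ContinuousLinearMap.fst ℂ ℂ ℂ).comp
      ((ContinuousLinearMap.snd ℂ ℂ (ℂ × ℂ)).comp
        ((ContinuousLinearMap.snd ℂ ℂ (ℂ × ℂ × ℂ)).comp (.snd ℂ ℂ (ℂ × ℂ × ℂ × ℂ))))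
    have e2 : fderiv ℂ (fderiv ℂ
        (fun x : ℂ × ℂ × ℂ × ℂ × ℂ => x.1 * x.2.2.1 + ε * (x.2.1 * x.2.2.2.1))) 0 (J₂ v) (J₁ w) =
        w.1 * v.1 + ε * (w.2.1 * v.2.1) := by
      refine (fderiv_fderiv_mul_add_mul π₁ π₃ π₂ π₄ (ε : ℂ) (J₂ v) (J₁ w)).trans ?_
      simp [π₁, π₂, π₃, π₄, hJ₁, hJ₂]
    have hTv : T (J₂ v) = (0, v.1 • star e₁ + v.2.1 • star e₂, (ε₀ : ℂ) * v.2.2) := by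
      rw [hT, hJ₂]; simp
    have hTw : T (J₁ w) = (w.1 • e₁ + w.2.1 • e₂, 0, (ε₀ : ℂ) * w.2.2) := by
      rw [hT, hJ₁]; simp
    have s1 : ((0, v.1 • star e₁ + v.2.1 • star e₂, 0) : (ℂ × ℂ) × (ℂ × ℂ) × ℂ) =
      v.1 • (0, star e₁, 0) + v.2.1 • (0, star e₂, 0) := by simp
    have s2 : ((w.1 • e₁ + w.2.1 • e₂, 0, 0) : (ℂ × ℂ) × (ℂ × ℂ) × ℂ) =
      w.1 • (e₁, 0, 0) + w.2.1 • (e₂, 0, 0) := by simp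
    rw [e1, e2, fderiv_fderiv_comp_apply hF.analyticAt, hTv, hTw, hF.hessian_mixed, s1, s2]
    simp only [map_add, map_smul, add_apply, smul_apply, smul_eq_mul, h₁, h₂, h₁₂, h₂₁]
    have hsq : (ε₀ : ℂ) * ε₀ = 1 := by rcases hε₀ with rfl | rfl <;> simp
    linear_combination (v.1 * w.1 + ε * v.2.1 * w.2.1) * hsq
  have hRdd : fderiv ℂ (fderiv ℂ R) 0 = 0 := by
    refine ContinuousLinearMap.ext fun v => ContinuousLinearMap.ext fun w => ?_
    have hmix' : ∀ v w, fderiv ℂ (fderiv ℂ R) 0 (J₁ v) (J₂ w) = 0 := fun v w => by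
      rw [fderiv_fderiv_symm hRa, hmix]
    rw [hdec v, hdec w]
    simp only [map_add, add_apply, hR2, hR2', hmix, hmix', add_zero, zero_apply]
  -- The last variable is kept complex so that the statement holds on a ball of `ℂ³`, then
  -- specialized to real values.
  have hreal : ∀ᶠ x in 𝓝 (0 : ℂ × ℂ × ℂ), ∀ u : ℝ, x.2.2 = (u : ℂ) →
      (R (x.1, x.2.1, conj x.1, conj x.2.1, (u : ℂ))).im = 0 := by
    filter_upwards [hF.hermitian.comp_continuousAt_zero
      (φ := fun x : ℂ × ℂ × ℂ => T (x.1, x.2.1, conj x.1, conj x.2.1, x.2.2)) (by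
        have hc : Continuous fun x : ℂ × ℂ × ℂ => (x.1, x.2.1, conj x.1, conj x.2.1, x.2.2) := by
          have := Complex.continuous_conj
          fun_prop
        exact (T.continuous.comp hc).continuousAt) (by
        simp [hT])] with x hx u hu
    rw [hu] at hx
    have e1 : star (T (x.1, x.2.1, conj x.1, conj x.2.1, (u : ℂ))).2.1 =
        (T (x.1, x.2.1, conj x.1, conj x.2.1, (u : ℂ))).1 := by
      simp only [hT, star_add, star_smul, star_star, Complex.star_def, Complex.conj_conj]
    have e2 : star (T (x.1, x.2.1, conj x.1, conj x.2.1, (u : ℂ))).1 =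
        (T (x.1, x.2.1, conj x.1, conj x.2.1, (u : ℂ))).2.1 := by
      simp only [hT, star_add, star_smul, Complex.star_def]
    have e3 : star (T (x.1, x.2.1, conj x.1, conj x.2.1, (u : ℂ))).2.2 =
        (T (x.1, x.2.1, conj x.1, conj x.2.1, (u : ℂ))).2.2 := by
      simp [hT]
    rw [e1, e2, e3] at hx
    have hx' : (F (T (x.1, x.2.1, conj x.1, conj x.2.1, (u : ℂ)))).im = 0 :=
      Complex.conj_eq_iff_im.1 hx
    rw [hR]
    simp only [Complex.sub_im, Complex.add_im, Complex.mul_conj,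
      Complex.im_ofReal_mul, hx', Complex.ofReal_im]
    simp
  obtain ⟨δ₁, hδ₁, hb₁⟩ := Metric.eventually_nhds_iff_ball.1 (z₁.and (z₂.and hreal))
  obtain ⟨δ₂, hδ₂, hb₂⟩ := Metric.eventually_nhds_iff_ball.1 hRa.eventually_analyticAt
  have hsub : ∀ x ∈ Metric.ball (0 : ℂ × ℂ × ℂ × ℂ × ℂ) (min δ₁ δ₂), ‖x‖ < δ₁ := by
    intro x hx
    exact (mem_ball_zero_iff.1 hx).trans_le (min_le_left _ _)
  refine ⟨min δ₁ δ₂, lt_min hδ₁ hδ₂, ?_, hRa.isBigO_norm_pow_three ?_ hRd hRdd, ?_, ?_, ?_⟩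
  · exact fun x hx => hb₂ x (Metric.ball_subset_ball (min_le_right _ _) hx)
  · simpa using hR0
  · intro w₁ w₂ u hx
    refine (hb₁ (w₁, w₂, (u : ℂ)) ?_).2.2 u rfl
    have := hsub _ hx
    -- The sup norm turns balls into polydiscs, so membership passes to the subtuple of free
    -- coordinates.
    simp only [Prod.norm_def, sup_lt_iff] at this
    simp only [mem_ball_zero_iff, Prod.norm_def, sup_lt_iff]
    exact ⟨this.1, this.2.1, this.2.2.2.2⟩
  · intro ζ₁ ζ₂ ν hx
    refine (hb₁ (ζ₁, ζ₂, ν) ?_).2.1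
    have := hsub _ hx
    simp only [Prod.norm_def, sup_lt_iff] at this
    simp only [mem_ball_zero_iff, Prod.norm_def, sup_lt_iff]
    exact this.2.2
  · intro w₁ w₂ ν hx
    refine (hb₁ (w₁, w₂, ν) ?_).1
    have := hsub _ hx
    simp only [Prod.norm_def, sup_lt_iff] at this
    simp only [mem_ball_zero_iff, Prod.norm_def, sup_lt_iff]
    exact ⟨this.1, this.2.1, this.2.2.2.2⟩

end IsNormalGerm

/-! ### Assembly of the final chart -/

/-- A chart that is analytic at a point together with its inverse restricts to a holomorphic chart
on whose image a given local property holds. -/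
theorem exists_holomorphic_restriction {P : OpenPartialHomeomorph CThree CThree} {p : CThree}
    (hp : p ∈ P.source) (hPp : P p = 0) (hP : AnalyticAt ℂ P p) (hPs : AnalyticAt ℂ P.symm 0)
    {C : CThree → Prop} (hC : ∀ᶠ x in 𝓝 0, C x) :
    ∃ Ψ : OpenPartialHomeomorph CThree CThree, IsHolomorphicChartAt Ψ p ∧
      (∀ x ∈ Ψ.target, C x) ∧ ∀ x, Ψ.symm x = P.symm x := by
  have hps : P.symm 0 = p := by rw [← hPp]; exact P.left_inv hp
  have e1 := hPs.continuousAt.eventually (by rw [hps]; exact hP.eventually_analyticAt)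
  obtain ⟨r, hr, hb⟩ := Metric.eventually_nhds_iff_ball.1
    (hC.and (e1.and hPs.eventually_analyticAt))
  -- The inverse chart is restricted, so that the ball is cut out in the target.
  have hsource : ∀ q, q ∈ (P.symm.restrOpen (Metric.ball 0 r) Metric.isOpen_ball).symm.source ↔
      q ∈ P.source ∧ P q ∈ Metric.ball 0 r := by
    intro q
    simp
  have htarget : ∀ x, x ∈ (P.symm.restrOpen (Metric.ball 0 r) Metric.isOpen_ball).symm.target ↔
      x ∈ P.target ∧ x ∈ Metric.ball 0 r := by
    intro x
    simp
  refine ⟨(P.symm.restrOpen (Metric.ball 0 r) Metric.isOpen_ball).symm, ⟨?_, ?_, ?_, ?_⟩, ?_, ?_⟩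
  · rw [hsource, hPp]
    exact ⟨hp, Metric.mem_ball_self hr⟩
  · exact hPp
  · intro q hq
    rw [hsource] at hq
    have := (hb _ hq.2).2.1
    rw [P.left_inv hq.1] at this
    exact this.differentiableAt.differentiableWithinAt
  · intro x hx
    rw [htarget] at hx
    exact (hb x hx.2).2.2.differentiableAt.differentiableWithinAt
  · intro x hx
    rw [htarget] at hx
    exact (hb x hx.2).1
  · intro x
    rfl

theorem mainTheorem7 (M : Set CThree) (hM : IsRealAnalyticHypersurface M)
    (hLevi : ∀ q ∈ M, HasLeviRank M q 2) (p : CThree) (hp : p ∈ M) :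
    ∃ (Ψ : OpenPartialHomeomorph CThree CThree) (ε : ℝ) (δ : ℝ) (R : ℂ × ℂ × ℂ × ℂ × ℂ → ℂ),
      IsHolomorphicChartAt Ψ p ∧ (ε = 1 ∨ ε = -1) ∧ 0 < δ ∧ IsNormalRemainder R δ ∧
      Ψ.target ⊆ Metric.ball 0 δ ∧
      ∀ z₁ z₂ w : ℂ, (z₁, z₂, w) ∈ Ψ.target →
        (Ψ.symm (z₁, z₂, w) ∈ M ↔
          (w.im : ℂ) = z₁ * conj z₁ + (ε : ℂ) * (z₂ * conj z₂)
            + R (z₁, z₂, conj z₁, conj z₂, (w.re : ℂ))) := by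
  obtain ⟨Ψ, F, hpΨ, hΨp, hΨ, hΨs, hFa, hFr, hFl, hFh, hFM⟩ := hM.exists_normal_chart hp
  have hF : IsNormalGerm F := ⟨hFa, hFr, hFl, hFh⟩
  let ι : ℂ × ℂ →ₗ[ℂ] (ℂ × ℂ) × (ℂ × ℂ) × ℂ := LinearMap.inl ℂ (ℂ × ℂ) ((ℂ × ℂ) × ℂ)
  let h : ℂ × ℂ → (ℂ × ℂ →ₗ[ℂ] ℂ) := fun y =>
    (fderiv ℂ (fderiv ℂ F) 0 (0, star y, 0)).toLinearMap ∘ₗ ι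
  have hh : ∀ y x, h y x = fderiv ℂ (fderiv ℂ F) 0 (0, star y, 0) (x, 0, 0) := fun _ _ => rfl
  obtain ⟨e₁, e₂, ε₀, ε, hε₀, hε, h₁, h₂, h₁₂, hind⟩ := exists_orthonormal_basis_of_hermitian h
    (fun x y => by rw [hh, hh, hF.hessian_star]) (fun x hx => by
      obtain ⟨β, hβ⟩ := (hLevi p hp).normal_germ_nondegenerate hp hpΨ hΨp hΨ hΨs hF hFM x hx
      exact ⟨star β, by rwa [hh, star_star]⟩)
  have hε₀0 : (ε₀ : ℂ) ≠ 0 := by rcases hε₀ with rfl | rfl <;> simp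
  obtain ⟨δ, hδ, hR⟩ := hF.exists_isNormalRemainder (ε := ε) hε₀ h₁ h₂ h₁₂
  let Λ₀ : CThree →ₗ[ℂ] (ℂ × ℂ) × ℂ :=
    { toFun := fun x => (x.1 • e₁ + x.2.1 • e₂, (ε₀ : ℂ) * x.2.2)
      map_add' := by
        intro x y
        refine Prod.ext ?_ ?_
        · simp only [Prod.fst_add, Prod.snd_add]; module
        · simp only [Prod.snd_add]; ring
      map_smul' := by
        intro c x
        refine Prod.ext ?_ ?_
        · simp only [Prod.smul_fst, Prod.smul_snd, smul_eq_mul, RingHom.id_apply]; module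
        · simp only [Prod.smul_snd, smul_eq_mul, RingHom.id_apply]; ring }
  have hΛ₀ : Function.Injective Λ₀ := by
    rw [← LinearMap.ker_eq_bot, LinearMap.ker_eq_bot']
    intro x hx
    have h1 := hind _ _ (congrArg Prod.fst hx)
    have h2 : (ε₀ : ℂ) * x.2.2 = 0 := congrArg Prod.snd hx
    exact Prod.ext h1.1 (Prod.ext h1.2 ((mul_eq_zero.1 h2).resolve_left hε₀0))
  let Λ : CThree ≃L[ℂ] (ℂ × ℂ) × ℂ :=
    (Λ₀.linearEquivOfInjective hΛ₀ (by simp)).toContinuousLinearEquiv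
  have hΛ : ∀ x, Λ x = (x.1 • e₁ + x.2.1 • e₂, (ε₀ : ℂ) * x.2.2) := fun _ => rfl
  let P : OpenPartialHomeomorph CThree CThree := Ψ.transHomeomorph Λ.symm.toHomeomorph
  have hPcoe : ∀ q, P q = Λ.symm (Ψ q) := fun _ => rfl
  have hPs : ∀ x, P.symm x = Ψ.symm (Λ x) := fun _ => rfl
  have hC : ∀ᶠ x : CThree in 𝓝 0, x ∈ Metric.ball (0 : CThree) δ ∧ (P.symm x ∈ M ↔
      (x.2.2.im : ℂ) = x.1 * conj x.1 + (ε : ℂ) * (x.2.1 * conj x.2.1)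
        + IsNormalGerm.remainder F e₁ e₂ ε₀ ε (x.1, x.2.1, conj x.1, conj x.2.1, (x.2.2.re : ℂ))) := by
    filter_upwards [Metric.ball_mem_nhds (0 : CThree) hδ,
      hFM.comp_continuousAt_zero Λ.continuous.continuousAt (map_zero Λ)] with x h1 h2
    refine ⟨h1, ?_⟩
    rw [hPs, h2, hΛ, IsNormalGerm.remainder, IsNormalGerm.frameMap_apply]
    simp only [star_add, star_smul, Complex.star_def, Complex.re_ofReal_mul, Complex.im_ofReal_mul,
      Complex.ofReal_mul]
    -- In the rescaled coordinate the graph equation reads `f = ε₀ v`; multiplying by `ε₀` inverts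
    -- it because `ε₀ ^ 2 = 1`.
    have hsq : (ε₀ : ℂ) * ε₀ = 1 := by rcases hε₀ with rfl | rfl <;> simp
    set f := F (x.1 • e₁ + x.2.1 • e₂, conj x.1 • star e₁ + conj x.2.1 • star e₂,
      (ε₀ : ℂ) * (x.2.2.re : ℂ))
    constructor
    · intro hf
      linear_combination -(ε₀ : ℂ) * hf - (x.2.2.im : ℂ) * hsq
    · intro hf
      linear_combination -(ε₀ : ℂ) * hf - f * hsq
  obtain ⟨Ψ', hchart, hprop, hsymm⟩ := exists_holomorphic_restriction (P := P) (p := p)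
    (by simpa [P] using hpΨ) (by rw [hPcoe, hΨp, map_zero])
    (AnalyticAt.comp (g := Λ.symm) (f := Ψ) (Λ.symm.toContinuousLinearMap.analyticAt _) hΨ)
    (AnalyticAt.comp_of_eq (g := Ψ.symm) (f := Λ) hΨs (Λ.toContinuousLinearMap.analyticAt 0)
      (map_zero Λ)) hC
  refine ⟨Ψ', ε, δ, IsNormalGerm.remainder F e₁ e₂ ε₀ ε, hchart, hε, hδ, hR,
    fun x hx => (hprop x hx).1, fun z₁ z₂ w hx => ?_⟩
  rw [hsymm]
  exact (hprop _ hx).2
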